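/- Let $\Phi$ be a field of characteristic $0$. All algebras are over $\Phi$ and are not assumed associative or unital; write $(a,b,c)=(ab)c-a(bc)$. For a superalgebra $A=A_0\oplus A_1$ (that is, a $\mathbb Z/2$-graded algebra) and homogeneous $a,b$ of parities $|a|,|b|$ put $[a,b]_s=ab-(-1)^{|a||b|}ba$. A superalgebra $A$ is a strongly $(-1,1)$-superalgebra if for all homogeneous $a,b,c\in A$ $$(a,b,c)+(-1)^{|b||c|}(a,c,b)=0,\qquad [[a,b]_s,c]_s=0,$$ $$(a,b,c)+(-1)^{|a|(|b|+|c|)}(b,c,a)+(-1)^{|c|(|a|+|b|)}(c,a,b)=0 .$$ A variety of strongly $(-1,1)$-superalgebras is the class of all strongly $(-1,1)$-superalgebras over $\Phi$ that satisfy a given set of graded identities, i.e. identities in even and odd variables. An even element $z\in A_0$ is called central if $za=az$ for all $a\in A$. Let $F[z;x]$ be the strongly $(-1,1)$-superalgebra freely generated by an even central element $z$ and an odd element $x$, i.e. the quotient of the free strongly $(-1,1)$-superalgebra on an even generator $z$ and an odd generator $x$ by the ideal generated by all $zf-fz$. Let $$F_0=F[z;x]/\bigl(x^2,\ ((z,x,x),x,x)\bigr).$$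 Proposition 4.1. Let $\mathcal V$ be a variety of strongly $(-1,1)$-superalgebras over $\Phi$. Then $\mathcal V$ is small, meaning that $F_0\notin\mathcal V$, if and only if there is an integer $k>0$ such that every $A\in\mathcal V$ satisfies $$(z,x,x)^k=0\quad\text{for every central } z\in A_0 \text{ and every } x\in A_1 ,$$ where $a^k$ denotes the left-normed power $(\cdots(aa)\cdots)a$. -/

import Mathlib

universe u

namespace MinusOneOne

section Superalgebras

variable {Φ : Type u} [Field Φ] {A : Type u} [NonUnitalNonAssocRing A] [Module Φ A]

/-- The Koszul sign `(-1)^{ij}` of two parities. -/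
def koszul (i j : ZMod 2) : ℤ := if i = 1 ∧ j = 1 then -1 else 1

/-- The supercommutator `[a, b]_s = ab - (-1)^{ij} ba` of an element `a` of parity `i` and an
element `b` of parity `j`. -/
def superComm (i j : ZMod 2) (a b : A) : A := a * b - koszul i j • (b * a)

/-- `𝒜 0 ⊕ 𝒜 1` is a `ℤ/2`-grading of the (not necessarily associative or unital) algebra `A`. -/
structure IsSuperalgebra (𝒜 : ZMod 2 → Submodule Φ A) : Prop where
  isCompl : IsCompl (𝒜 0) (𝒜 1)
  mul_mem : ∀ {i j : ZMod 2} {a b : A}, a ∈ 𝒜 i → b ∈ 𝒜 j → a * b ∈ 𝒜 (i + j)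

/-- Strongly (-1,1)-superalgebras: the superizations of the identities
`(x, y, z) + (x, z, y) = 0` (linearized right alternativity),
`(x, y, z) + (y, z, x) + (z, x, y) = 0` and `[[x, y], z] = 0`. -/
structure IsStronglyMinusOneOne (𝒜 : ZMod 2 → Submodule Φ A) : Prop
    extends IsSuperalgebra 𝒜 where
  right_alternative : ∀ {i j k : ZMod 2} {a b c : A}, a ∈ 𝒜 i → b ∈ 𝒜 j → c ∈ 𝒜 k →
    associator a b c + koszul j k • associator a c b = 0
  cyclic : ∀ {i j k : ZMod 2} {a b c : A}, a ∈ 𝒜 i → b ∈ 𝒜 j → c ∈ 𝒜 k →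
    associator a b c + koszul i (j + k) • associator b c a
      + koszul k (i + j) • associator c a b = 0
  comm_comm : ∀ {i j k : ZMod 2} {a b c : A}, a ∈ 𝒜 i → b ∈ 𝒜 j → c ∈ 𝒜 k →
    superComm (i + j) k (superComm i j a b) c = 0

/-- The left-normed power `a ^ k = (⋯((a a) a)⋯) a`, for `k ≥ 1` (the value at `k = 0` is junk). -/
def leftPow (a : A) : ℕ → A
  | 0 => 0
  | 1 => a
  | (k + 2) => leftPow a (k + 1) * a

end Superalgebras

section Varieties

/-- Graded nonassociative polynomials over `Φ` without constant term; the variable `(n, i)` is the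
`n`-th variable of parity `i`. -/
abbrev SuperPolynomial (Φ : Type u) [Field Φ] : Type u :=
  FreeNonUnitalNonAssocAlgebra Φ (ℕ × ZMod 2)

/-- `f = 0` is a (graded) identity of the superalgebra `A`: it vanishes under every substitution
of elements of `A` for the variables that respects parities. -/
def IsSuperIdentity {Φ : Type u} [Field Φ] {A : Type u} [NonUnitalNonAssocRing A] [Module Φ A]
    [IsScalarTower Φ A A] [SMulCommClass Φ A A] (𝒜 : ZMod 2 → Submodule Φ A)
    (f : SuperPolynomial Φ) : Prop :=
  ∀ v : ℕ × ZMod 2 → A, (∀ q, v q ∈ 𝒜 q.2) → FreeNonUnitalNonAssocAlgebra.lift Φ v f = 0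

/-- A variety of strongly (-1,1)-superalgebras over `Φ`, given by the graded identities that
define it within the class of all strongly (-1,1)-superalgebras. -/
structure StronglyVariety (Φ : Type u) [Field Φ] where
  identities : Set (SuperPolynomial Φ)

/-- The superalgebra `A` belongs to the variety `V`. -/
structure StronglyVariety.Contains {Φ : Type u} [Field Φ] (V : StronglyVariety Φ)
    {A : Type u} [NonUnitalNonAssocRing A] [Module Φ A]
    [IsScalarTower Φ A A] [SMulCommClass Φ A A] (𝒜 : ZMod 2 → Submodule Φ A) : Prop where
  strongly : IsStronglyMinusOneOne 𝒜
  satisfies : ∀ f ∈ V.identities, IsSuperIdentity 𝒜 f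

end Varieties

section Quotients

variable (Φ : Type u) [Field Φ] {A : Type u} [NonUnitalNonAssocRing A] [Module Φ A]

/-- Two-sided ideals of a `Φ`-algebra. -/
def IsIdeal (I : Submodule Φ A) : Prop := ∀ a ∈ I, ∀ b : A, a * b ∈ I ∧ b * a ∈ I

/-- The two-sided ideal generated by a set. -/
def idealSpan (S : Set A) : Submodule Φ A := sInf {I | IsIdeal Φ I ∧ S ⊆ I}

theorem subset_idealSpan (S : Set A) : S ⊆ idealSpan Φ S := fun _ ha =>
  Submodule.mem_sInf.2 fun _ hI => hI.2 ha

theorem isIdeal_idealSpan (S : Set A) : IsIdeal Φ (idealSpan Φ S) := fun _ ha b =>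
  ⟨Submodule.mem_sInf.2 fun I hI => (hI.1 _ (Submodule.mem_sInf.1 ha I hI) b).1,
    Submodule.mem_sInf.2 fun I hI => (hI.1 _ (Submodule.mem_sInf.1 ha I hI) b).2⟩

theorem idealSpan_le {S : Set A} {I : Submodule Φ A} (hI : IsIdeal Φ I) (hS : S ⊆ I) :
    idealSpan Φ S ≤ I := sInf_le ⟨hI, hS⟩

/-- The quotient algebra of `A` by the ideal generated by `S`. -/
abbrev IdealQuotient (S : Set A) : Type u := A ⧸ idealSpan Φ S

instance (S : Set A) : Mul (IdealQuotient Φ S) where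
  mul := Quotient.map₂ (· * ·) (by
    intro a a' ha b b' hb
    have ha' := (Submodule.quotientRel_def _).1 ha
    have hb' := (Submodule.quotientRel_def _).1 hb
    refine (Submodule.quotientRel_def _).2 ?_
    have h : a * b - a' * b' = (a - a') * b + a' * (b - b') := by
      rw [sub_mul, mul_sub]; abel
    rw [h]
    exact add_mem (isIdeal_idealSpan Φ S _ ha' b).1 (isIdeal_idealSpan Φ S _ hb' a').2)

theorem mk_mul (S : Set A) (a b : A) :
    (Submodule.Quotient.mk (a * b) : IdealQuotient Φ S)
      = Submodule.Quotient.mk a * Submodule.Quotient.mk b := rfl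

instance (S : Set A) : NonUnitalNonAssocRing (IdealQuotient Φ S) where
  left_distrib := by
    rintro ⟨a⟩ ⟨b⟩ ⟨c⟩
    exact congrArg (Submodule.Quotient.mk (p := idealSpan Φ S)) (mul_add a b c)
  right_distrib := by
    rintro ⟨a⟩ ⟨b⟩ ⟨c⟩
    exact congrArg (Submodule.Quotient.mk (p := idealSpan Φ S)) (add_mul a b c)
  zero_mul := by
    rintro ⟨a⟩
    exact congrArg (Submodule.Quotient.mk (p := idealSpan Φ S)) (zero_mul a)
  mul_zero := by
    rintro ⟨a⟩
    exact congrArg (Submodule.Quotient.mk (p := idealSpan Φ S)) (mul_zero a)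

instance [IsScalarTower Φ A A] (S : Set A) :
    IsScalarTower Φ (IdealQuotient Φ S) (IdealQuotient Φ S) where
  smul_assoc := by
    rintro r ⟨a⟩ ⟨b⟩
    exact congrArg (Submodule.Quotient.mk (p := idealSpan Φ S)) (smul_mul_assoc r a b)

instance [SMulCommClass Φ A A] (S : Set A) :
    SMulCommClass Φ (IdealQuotient Φ S) (IdealQuotient Φ S) where
  smul_comm := by
    rintro r ⟨a⟩ ⟨b⟩
    exact congrArg (Submodule.Quotient.mk (p := idealSpan Φ S)) (mul_smul_comm r a b).symm

/-- The images of the homogeneous components of `A` in the quotient of `A` by the ideal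
generated by `S`. -/
def quotientGrading (𝒜 : ZMod 2 → Submodule Φ A) (S : Set A) (i : ZMod 2) :
    Submodule Φ (IdealQuotient Φ S) :=
  (𝒜 i).map (idealSpan Φ S).mkQ

end Quotients

section FreeSuperalgebra

variable (Φ : Type u) [Field Φ] {X : Type}

/-- The parity of a nonassociative monomial in variables of given parities. -/
def monomialParity (p : X → ZMod 2) : FreeMagma X → ZMod 2
  | .of x => p x
  | .mul v w => monomialParity p v + monomialParity p w

/-- The grading of the free nonassociative algebra on generators of given parities: the component
of parity `i` is spanned by the monomials of parity `i`. -/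
noncomputable def freeGrading (p : X → ZMod 2) (i : ZMod 2) : Submodule Φ (FreeNonUnitalNonAssocAlgebra Φ X) :=
  MonoidAlgebra.supported Φ Φ {w | monomialParity p w = i}

end FreeSuperalgebra

section SuperalgebraF0

/-- The two generators of `F₀`. -/
inductive Gen : Type
  | z
  | x

/-- The generator `z` is even and the generator `x` is odd. -/
def Gen.parity : Gen → ZMod 2
  | .z => 0
  | .x => 1

variable (Φ : Type u) [Field Φ]

/-- The free nonassociative superalgebra on an even generator `z` and an odd generator `x`. -/
abbrev FreeZX : Type u := FreeNonUnitalNonAssocAlgebra Φ Gen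

/-- The even generator. -/
noncomputable def genZ : FreeZX Φ := FreeNonUnitalNonAssocAlgebra.of Φ Gen.z

/-- The odd generator. -/
noncomputable def genX : FreeZX Φ := FreeNonUnitalNonAssocAlgebra.of Φ Gen.x

/-- The defining relators of `F₀`. The first three families define the free strongly
(-1,1)-superalgebra on `z` and `x`; the fourth one makes `z` central and so defines `F[z; x]`;
the last two are `x²` and `((z, x, x), x, x)`. -/
inductive F0Relator : FreeZX Φ → Prop
  | right_alternative {i j k : ZMod 2} {a b c : FreeZX Φ}
      (ha : a ∈ freeGrading Φ Gen.parity i) (hb : b ∈ freeGrading Φ Gen.parity j)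
      (hc : c ∈ freeGrading Φ Gen.parity k) :
      F0Relator (associator a b c + koszul j k • associator a c b)
  | cyclic {i j k : ZMod 2} {a b c : FreeZX Φ}
      (ha : a ∈ freeGrading Φ Gen.parity i) (hb : b ∈ freeGrading Φ Gen.parity j)
      (hc : c ∈ freeGrading Φ Gen.parity k) :
      F0Relator (associator a b c + koszul i (j + k) • associator b c a
        + koszul k (i + j) • associator c a b)
  | comm_comm {i j k : ZMod 2} {a b c : FreeZX Φ}
      (ha : a ∈ freeGrading Φ Gen.parity i) (hb : b ∈ freeGrading Φ Gen.parity j)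
      (hc : c ∈ freeGrading Φ Gen.parity k) :
      F0Relator (superComm (i + j) k (superComm i j a b) c)
  | central (f : FreeZX Φ) : F0Relator (genZ Φ * f - f * genZ Φ)
  | x_sq : F0Relator (genX Φ * genX Φ)
  | zxx : F0Relator (associator (associator (genZ Φ) (genX Φ) (genX Φ)) (genX Φ) (genX Φ))

/-- The superalgebra `F₀ = F[z; x] / (x², ((z, x, x), x, x))`. -/
abbrev F0 : Type u := IdealQuotient Φ {r : FreeZX Φ | F0Relator Φ r}

/-- The grading of `F₀` induced by the parities of the generators. -/
noncomputable def F0grading : ZMod 2 → Submodule Φ (F0 Φ) :=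
  quotientGrading Φ (freeGrading Φ Gen.parity) {r : FreeZX Φ | F0Relator Φ r}

end SuperalgebraF0

/-- A variety of strongly (-1,1)-superalgebras is small if it does not contain `F₀`. -/
def StronglyVariety.IsSmall {Φ : Type u} [Field Φ] (V : StronglyVariety Φ) : Prop :=
  ¬ V.Contains (F0grading Φ)

end MinusOneOne

/-! Everything is controlled by commutative differential algebra. In the unital hull of a strongly
(-1,1)-superalgebra the even central elements form a commutative ring `S`, an odd `x` gives a
derivation `D = ½(·, x, x)` of `S`, and `x²` lies in `S`. The product `(ax)(bx) = ab x² + 2 D(a) b +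
a D(b)` is then forced, so the double `S ⊕ Sx` maps homomorphically to the hull
(`CenterRing.doubleHom`). Applied to `F₀` itself, this embeds `F₀` in the double of `Φ[T][Z]` with
`D = T ∂/∂Z` and `x² = 0` (`toModel_injective`). There `(z, x, x) = 2T` is not nilpotent, so a bound
`k` excludes `F₀` from the variety.

Conversely, let `f` be an identity of the variety that fails in `F₀`, hence in the model. Given `A`,
`z`, `x`, put `t = D z`. Substituting `y = (z + u)/c²` and `cx` for `x` makes `S[y]`, with
derivation `c² D + t d/dy` and odd square `c² x²`, specialize to the double of `S`. Everything is
polynomial in `c²`, so `c → 0` is legitimate and leaves the derivation `t d/dy` with odd square `0`: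
this is the model at `T = t` (`doubleEval_scaledDerivative`). So a nonzero coefficient `q(T)` of a
value of `f` in the model gives `t q(t) = 0`, the factor `t` absorbing the possible kernel of `b ↦
bx`. Replacing `x` by `cx` replaces `t` by `c² t`; comparing leading terms gives `t ^ k = 0` with `k
= deg (T q)`, which depends on `f` alone and not on `A`. -/

namespace MinusOneOne

/-! ### Doubles of commutative differential algebras -/

section DifferentialDouble

variable {Φ S S' : Type u} [Field Φ] [CommRing S] [Algebra Φ S] [CommRing S'] [Algebra Φ S']

/-- The superalgebra `S ⊕ Sx` attached to a commutative algebra `S` with a derivation `D` and an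
element `γ`, in which `x² = γ` and `(s, x, x) = 2 D s`. -/
def Double (_D : Derivation Φ S S) (_γ : S) : Type u := S × S

namespace Double

variable {D : Derivation Φ S S} {γ : S} {D' : Derivation Φ S' S'} {γ' : S'}

/-- The element `a + bx`. -/
def mk (a b : S) : Double D γ := (a, b)

/-- The component in `S`. -/
def even (p : Double D γ) : S := p.1

/-- The coefficient of `x`. -/
def odd (p : Double D γ) : S := p.2

@[simp] theorem even_mk (a b : S) : (mk a b : Double D γ).even = a := rfl
@[simp] theorem odd_mk (a b : S) : (mk a b : Double D γ).odd = b := rfl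

@[ext] theorem ext {p q : Double D γ} (h₀ : p.even = q.even) (h₁ : p.odd = q.odd) : p = q :=
  Prod.ext h₀ h₁

instance : AddCommGroup (Double D γ) := inferInstanceAs (AddCommGroup (S × S))

instance : Module Φ (Double D γ) := inferInstanceAs (Module Φ (S × S))

instance : Mul (Double D γ) where
  mul p q := mk (p.even * q.even + γ * p.odd * q.odd + 2 * D p.odd * q.odd + p.odd * D q.odd)
    (p.even * q.odd + p.odd * q.even)

@[simp] theorem even_zero : (0 : Double D γ).even = 0 := rfl
@[simp] theorem odd_zero : (0 : Double D γ).odd = 0 := rfl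
@[simp] theorem even_add (p q : Double D γ) : (p + q).even = p.even + q.even := rfl
@[simp] theorem odd_add (p q : Double D γ) : (p + q).odd = p.odd + q.odd := rfl
@[simp] theorem even_sub (p q : Double D γ) : (p - q).even = p.even - q.even := rfl
@[simp] theorem odd_sub (p q : Double D γ) : (p - q).odd = p.odd - q.odd := rfl
@[simp] theorem even_neg (p : Double D γ) : (-p).even = -p.even := rfl
@[simp] theorem odd_neg (p : Double D γ) : (-p).odd = -p.odd := rfl
@[simp] theorem even_smul (c : Φ) (p : Double D γ) : (c • p).even = c • p.even := rfl
@[simp] theorem odd_smul (c : Φ) (p : Double D γ) : (c • p).odd = c • p.odd := rfl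
@[simp] theorem even_mul (p q : Double D γ) : (p * q).even =
    p.even * q.even + γ * p.odd * q.odd + 2 * D p.odd * q.odd + p.odd * D q.odd := rfl
@[simp] theorem odd_mul (p q : Double D γ) :
    (p * q).odd = p.even * q.odd + p.odd * q.even := rfl

instance : NonUnitalNonAssocRing (Double D γ) where
  left_distrib p q r := by ext <;> simp <;> ring
  right_distrib p q r := by ext <;> simp <;> ring
  zero_mul p := by ext <;> simp
  mul_zero p := by ext <;> simp

instance : IsScalarTower Φ (Double D γ) (Double D γ) where
  smul_assoc c p q := by
    ext <;> simp [Algebra.smul_def] <;> ring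

instance : SMulCommClass Φ (Double D γ) (Double D γ) where
  smul_comm c p q := by
    ext <;> simp [Algebra.smul_def] <;> ring

/-- The homomorphism induced by a homomorphism of differential algebras. -/
def map (g : S →ₐ[Φ] S') (hD : ∀ s, g (D s) = D' (g s)) (hγ : g γ = γ') :
    Double D γ →ₙₐ[Φ] Double D' γ' where
  toFun p := mk (g p.even) (g p.odd)
  map_smul' c p := by ext <;> simp
  map_zero' := by ext <;> simp
  map_add' p q := by ext <;> simp
  map_mul' p q := by ext <;> simp [hD, hγ, map_ofNat g]

@[simp] theorem even_map (g : S →ₐ[Φ] S') (hD : ∀ s, g (D s) = D' (g s)) (hγ : g γ = γ')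
    (p : Double D γ) : (map g hD hγ p).even = g p.even := rfl
@[simp] theorem odd_map (g : S →ₐ[Φ] S') (hD : ∀ s, g (D s) = D' (g s)) (hγ : g γ = γ')
    (p : Double D γ) : (map g hD hγ p).odd = g p.odd := rfl

/-- Replacing `x` by `cx` multiplies `D` and `γ` by `c²`. -/
def scale (c : Φ) : Double (c ^ 2 • D) (c ^ 2 • γ) →ₙₐ[Φ] Double D γ where
  toFun p := mk p.even (c • p.odd)
  map_smul' r p := by ext <;> simp [smul_comm c r]
  map_zero' := by ext <;> simp
  map_add' p q := by ext <;> simp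
  map_mul' p q := by ext <;> simp [Algebra.smul_def] <;> ring

variable (D γ) in
/-- The grading of `S ⊕ Sx` with even part `S` and odd part `Sx`. -/
def grading (i : ZMod 2) : Submodule Φ (Double D γ) where
  carrier := {p | if i = 0 then p.odd = 0 else p.even = 0}
  add_mem' {p q} hp hq := by
    split_ifs at * with h <;> simp_all
  zero_mem' := by simp
  smul_mem' c p hp := by
    split_ifs at * with h <;> simp_all

@[simp] theorem mem_grading_zero {p : Double D γ} : p ∈ grading D γ 0 ↔ p.odd = 0 := by
  simp [grading, ← SetLike.mem_coe]

@[simp] theorem mem_grading_one {p : Double D γ} : p ∈ grading D γ 1 ↔ p.even = 0 := by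
  simp [grading, ← SetLike.mem_coe]

end Double

end DifferentialDouble

/-- The identities of strongly (-1,1)-superalgebras, for an algebra that is the not necessarily
direct sum of an even and an odd subspace. -/
structure HasStronglyIdentities {Φ : Type u} [Field Φ] {A : Type u} [NonUnitalNonAssocRing A]
    [Module Φ A] (𝒜 : ZMod 2 → Submodule Φ A) : Prop where
  codisjoint : Codisjoint (𝒜 0) (𝒜 1)
  mul_mem : ∀ {i j : ZMod 2} {a b : A}, a ∈ 𝒜 i → b ∈ 𝒜 j → a * b ∈ 𝒜 (i + j)
  right_alternative : ∀ {i j k : ZMod 2} {a b c : A}, a ∈ 𝒜 i → b ∈ 𝒜 j → c ∈ 𝒜 k →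
    associator a b c + koszul j k • associator a c b = 0
  cyclic : ∀ {i j k : ZMod 2} {a b c : A}, a ∈ 𝒜 i → b ∈ 𝒜 j → c ∈ 𝒜 k →
    associator a b c + koszul i (j + k) • associator b c a
      + koszul k (i + j) • associator c a b = 0
  comm_comm : ∀ {i j k : ZMod 2} {a b c : A}, a ∈ 𝒜 i → b ∈ 𝒜 j → c ∈ 𝒜 k →
    superComm (i + j) k (superComm i j a b) c = 0

theorem IsStronglyMinusOneOne.hasStronglyIdentities {Φ : Type u} [Field Φ] {A : Type u}
    [NonUnitalNonAssocRing A] [Module Φ A] {𝒜 : ZMod 2 → Submodule Φ A}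
    (h : IsStronglyMinusOneOne 𝒜) : HasStronglyIdentities 𝒜 :=
  ⟨h.isCompl.codisjoint, h.mul_mem, h.right_alternative, h.cyclic, h.comm_comm⟩

theorem zmod_two_cases (i : ZMod 2) : i = 0 ∨ i = 1 := by
  revert i; decide

@[simp] theorem koszul_zero_left (j : ZMod 2) : koszul 0 j = 1 := by simp [koszul]
@[simp] theorem koszul_zero_right (j : ZMod 2) : koszul j 0 = 1 := by simp [koszul]
@[simp] theorem koszul_one_one : koszul 1 1 = -1 := by simp [koszul]
@[simp] theorem zmod_two_one_add_one : (1 + 1 : ZMod 2) = 0 := by decide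

/-- For each pattern of parities the Leibniz rule reduces both components to an identity in a
commutative ring. The weights 2 and 1 in the product are those forced by `CenterRing.mul_mul_mul`.
-/
theorem Double.hasStronglyIdentities {Φ S : Type u} [Field Φ] [CommRing S] [Algebra Φ S]
    (D : Derivation Φ S S) (γ : S) : HasStronglyIdentities (grading D γ) where
  codisjoint := by
    rw [codisjoint_iff, eq_top_iff]
    intro p _
    have : p = mk p.even 0 + mk 0 p.odd := by ext <;> simp
    rw [this]
    exact Submodule.add_mem_sup (by simp) (by simp)
  mul_mem {i j a b} ha hb := by
    rcases zmod_two_cases i with rfl | rfl <;> rcases zmod_two_cases j with rfl | rfl <;>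
      simp at * <;> simp [ha, hb]
  right_alternative {i j k a b c} ha hb hc := by
    rcases zmod_two_cases i with rfl | rfl <;> rcases zmod_two_cases j with rfl | rfl <;>
      rcases zmod_two_cases k with rfl | rfl <;> simp at ha hb hc <;>
      ext <;> simp [associator_apply, ha, hb, hc] <;> ring
  cyclic {i j k a b c} ha hb hc := by
    rcases zmod_two_cases i with rfl | rfl <;> rcases zmod_two_cases j with rfl | rfl <;>
      rcases zmod_two_cases k with rfl | rfl <;> simp at ha hb hc <;>
      ext <;> simp [associator_apply, ha, hb, hc] <;> ring
  comm_comm {i j k a b c} ha hb hc := by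
    rcases zmod_two_cases i with rfl | rfl <;> rcases zmod_two_cases j with rfl | rfl <;>
      rcases zmod_two_cases k with rfl | rfl <;> simp at ha hb hc <;>
      ext <;> simp [superComm, ha, hb, hc] <;> ring

/-! ### Even central elements and the derivation given by an odd element -/

section EvenCenter

variable {Φ A : Type u} [Field Φ] [NonUnitalNonAssocRing A] [Module Φ A]

theorem HasStronglyIdentities.exists_add {𝒜 : ZMod 2 → Submodule Φ A}
    (h : HasStronglyIdentities 𝒜) (a : A) :
    ∃ a₀ ∈ 𝒜 0, ∃ a₁ ∈ 𝒜 1, a₀ + a₁ = a :=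
  Submodule.mem_sup.1 (h.codisjoint.eq_top ▸ Submodule.mem_top)

/-- The even central elements. -/
def evenCenter (𝒜 : ZMod 2 → Submodule Φ A) [IsScalarTower Φ A A] [SMulCommClass Φ A A] :
    Submodule Φ A where
  carrier := {a | a ∈ 𝒜 0 ∧ ∀ b, a * b = b * a}
  add_mem' ha hb := ⟨add_mem ha.1 hb.1, fun c => by rw [add_mul, mul_add, ha.2, hb.2]⟩
  zero_mem' := ⟨zero_mem _, by simp⟩
  smul_mem' r a ha := ⟨Submodule.smul_mem _ r ha.1, fun b => by
    rw [smul_mul_assoc, mul_smul_comm, ha.2]⟩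

variable [IsScalarTower Φ A A] [SMulCommClass Φ A A]
  {𝒜 : ZMod 2 → Submodule Φ A} {a b c w x z : A}

namespace HasStronglyIdentities

theorem mem_evenCenter_of_homogeneous (h : HasStronglyIdentities 𝒜) (hz : z ∈ 𝒜 0)
    (hc : ∀ i, ∀ b ∈ 𝒜 i, z * b = b * z) : z ∈ evenCenter 𝒜 := by
  refine ⟨hz, fun b => ?_⟩
  obtain ⟨b₀, h₀, b₁, h₁, rfl⟩ := h.exists_add b
  rw [mul_add, add_mul, hc 0 _ h₀, hc 1 _ h₁]

theorem associator_central_right (h : HasStronglyIdentities 𝒜) (hz : z ∈ evenCenter 𝒜) (a b : A) :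
    associator a b z = -associator a z b := by
  obtain ⟨a₀, ha₀, a₁, ha₁, rfl⟩ := h.exists_add a
  obtain ⟨b₀, hb₀, b₁, hb₁, rfl⟩ := h.exists_add b
  have h₀₀ := h.right_alternative ha₀ hb₀ hz.1
  have h₀₁ := h.right_alternative ha₀ hb₁ hz.1
  have h₁₀ := h.right_alternative ha₁ hb₀ hz.1
  have h₁₁ := h.right_alternative ha₁ hb₁ hz.1
  simp only [koszul_zero_right, one_smul, associator_apply] at *
  simp only [add_mul, mul_add]
  linear_combination (norm := module) h₀₀ + h₀₁ + h₁₀ + h₁₁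

/-- For `z` commuting with everything, `(a, b, z) - (a, z, b) + (z, a, b) = 0` holds in any algebra;
right alternativity turns the first term into `-(a, z, b)`. -/
theorem associator_central_left (h : HasStronglyIdentities 𝒜) (hz : z ∈ evenCenter 𝒜) (a b : A) :
    associator z a b = (2 : Φ) • associator a z b := by
  have h₁ := h.associator_central_right hz a b
  have h₂ : associator a b z - associator a z b + associator z a b = 0 := by
    simp only [associator_apply, hz.2]
    abel
  rw [h₁] at h₂
  linear_combination (norm := module) h₂

variable [CharZero Φ]

/-- Moving each of two central elements out of first place doubles the associator, so `(z, w, a) = 2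
(w, z, a) = 4 (z, w, a)`. -/
theorem associator_central_central_left (h : HasStronglyIdentities 𝒜) (hz : z ∈ evenCenter 𝒜)
    (hw : w ∈ evenCenter 𝒜) (a : A) : associator z w a = 0 := by
  have h₁ := h.associator_central_left hz w a
  rw [h.associator_central_left hw z a] at h₁
  have h₂ : (3 : Φ) • associator z w a = 0 := by linear_combination (norm := module) -h₁
  exact (smul_eq_zero.1 h₂).resolve_left (by norm_num)

theorem associator_central_mid (h : HasStronglyIdentities 𝒜) (hz : z ∈ evenCenter 𝒜)
    (hw : w ∈ evenCenter 𝒜) (a : A) : associator z a w = 0 := by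
  rw [h.associator_central_right hw, h.associator_central_central_left hz hw, neg_zero]

theorem associator_central_central_right (h : HasStronglyIdentities 𝒜) (hz : z ∈ evenCenter 𝒜)
    (hw : w ∈ evenCenter 𝒜) (a : A) : associator a z w = 0 := by
  have h₁ := h.associator_central_left hz a w
  rw [h.associator_central_mid hz hw] at h₁
  exact (smul_eq_zero.1 h₁.symm).resolve_left (by norm_num)

theorem central_mul_mul (h : HasStronglyIdentities 𝒜) (hz : z ∈ evenCenter 𝒜)
    (hw : w ∈ evenCenter 𝒜) (a : A) : z * w * a = z * (w * a) :=
  sub_eq_zero.1 (h.associator_central_central_left hz hw a)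

theorem mul_mem_evenCenter (h : HasStronglyIdentities 𝒜) (hz : z ∈ evenCenter 𝒜)
    (hw : w ∈ evenCenter 𝒜) : z * w ∈ evenCenter 𝒜 := by
  refine ⟨by simpa using h.mul_mem hz.1 hw.1, fun a => ?_⟩
  have h₁ := sub_eq_zero.1 (h.associator_central_mid hz hw a)
  have h₂ := sub_eq_zero.1 (h.associator_central_central_right hz hw a)
  rw [h.central_mul_mul hz hw, hw.2, ← h₁, hz.2, h₂]

/-- For odd `x` the supercommutator `[x, x]_s` is `2x²`, and supercommutators supercommute with
everything. -/
theorem mul_self_mem_evenCenter (h : HasStronglyIdentities 𝒜) (hx : x ∈ 𝒜 1) :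
    x * x ∈ evenCenter 𝒜 := by
  refine h.mem_evenCenter_of_homogeneous (by simpa using h.mul_mem hx hx) fun i b hb => ?_
  have h₁ := h.comm_comm hx hx hb
  simp only [superComm, koszul_one_one, zmod_two_one_add_one, koszul_zero_left, neg_smul, one_smul,
    sub_neg_eq_add, add_mul, mul_add] at h₁
  have h₂ : (2 : Φ) • (x * x * b - b * (x * x)) = 0 := by
    linear_combination (norm := module) h₁
  exact sub_eq_zero.1 ((smul_eq_zero.1 h₂).resolve_left (by norm_num))

theorem mul_central_mul (h : HasStronglyIdentities 𝒜) (hz : z ∈ evenCenter 𝒜) (x : A) :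
    x * (z * x) = z * x * x - (2⁻¹ : Φ) • associator z x x := by
  rw [h.associator_central_left hz, smul_smul, inv_mul_cancel₀ two_ne_zero, one_smul,
    associator_apply, hz.2 x]
  abel

theorem associator_mem_evenCenter (h : HasStronglyIdentities 𝒜) (hz : z ∈ evenCenter 𝒜)
    (hx : x ∈ 𝒜 1) : associator z x x ∈ evenCenter 𝒜 := by
  have hzx : z * x ∈ 𝒜 1 := by simpa using h.mul_mem hz.1 hx
  -- This element is `[zx, x]_s`. Since `x(zx) = ½((zx)x + z x²)`, it equals `3/2 (zx)x + ½ z x²`,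
  -- whence the coefficients 2/3 and 4/3 below.
  have hc : z * x * x + x * (z * x) ∈ evenCenter 𝒜 := by
    refine h.mem_evenCenter_of_homogeneous (add_mem (by simpa using h.mul_mem hzx hx)
      (by simpa using h.mul_mem hx hzx)) fun i b hb => ?_
    have h₁ := h.comm_comm hzx hx hb
    simpa [superComm, sub_eq_zero] using h₁
  have hγ := h.mul_mem_evenCenter hz (h.mul_self_mem_evenCenter hx)
  have h₁ := h.mul_central_mul hz x
  have h₂ : associator z x x = (2 / 3 : Φ) • (z * x * x + x * (z * x)) -
      (4 / 3 : Φ) • (z * (x * x)) := by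
    rw [h₁, associator_apply]
    match_scalars <;> norm_num
  rw [h₂]
  exact sub_mem (Submodule.smul_mem _ _ hc) (Submodule.smul_mem _ _ hγ)

/-- In the cocycle identity for `w, x, z, x` the terms `(w, xz, x)` and `(w, x, zx)` cancel: `xz =
zx` is odd, and right superalternativity is symmetric in two odd arguments. -/
theorem associator_mul_central (h : HasStronglyIdentities 𝒜) (hw : w ∈ evenCenter 𝒜)
    (hz : z ∈ evenCenter 𝒜) (hx : x ∈ 𝒜 1) :
    associator (w * x) z x = w * associator x z x := by
  have h₁ := associator_cocycle w x z x
  have hzx : x * z ∈ 𝒜 1 := by simpa using h.mul_mem hx hz.1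
  have h₂ := h.right_alternative hw.1 hzx hx
  rw [h.associator_central_mid hw hz, hz.2 x] at h₁
  simp only [koszul_one_one, neg_smul, one_smul] at h₂
  rw [zero_mul] at h₁
  linear_combination (norm := module) h₂ - h₁

/-- The Leibniz rule for `(·, x, x)`. In the cocycle identity for `z, w, x, x` the surviving
correction is `(z, wx, x) = 2 (wx, z, x) = 2w (x, z, x) = w (z, x, x)`. -/
theorem associator_central_mul (h : HasStronglyIdentities 𝒜) (hw : w ∈ evenCenter 𝒜)
    (hz : z ∈ evenCenter 𝒜) (hx : x ∈ 𝒜 1) :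
    associator (z * w) x x = z * associator w x x + w * associator z x x := by
  have h₁ := associator_cocycle z w x x
  rw [h.associator_central_central_left hz hw, h.associator_central_central_left hz hw,
    h.associator_central_left hz (w * x) x, h.associator_mul_central hw hz hx, zero_mul] at h₁
  rw [h.associator_central_left hz x x, mul_smul_comm]
  linear_combination (norm := module) -h₁

end HasStronglyIdentities

end EvenCenter

/-! ### The even centre as a differential ring, and its double -/

section CenterRing

variable {Φ E : Type u} [Field Φ] [NonAssocRing E] [Module Φ E] [IsScalarTower Φ E E]
  [SMulCommClass Φ E E] {ℰ : ZMod 2 → Submodule Φ E}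

/-- The even centre of a unital algebra with the strongly (-1,1)-identities, as a ring. -/
def CenterRing (_h : HasStronglyIdentities ℰ) (_h₁ : (1 : E) ∈ ℰ 0) : Type u := evenCenter ℰ

namespace CenterRing

variable {h : HasStronglyIdentities ℰ} {h₁ : (1 : E) ∈ ℰ 0}

/-- An element of the even centre as an element of the algebra. -/
def val (a : CenterRing h h₁) : E := a.1

variable (h h₁) in
/-- An even central element as an element of the even centre. -/
def mk (a : E) (ha : a ∈ evenCenter ℰ) : CenterRing h h₁ := ⟨a, ha⟩

theorem val_mem (a : CenterRing h h₁) : a.val ∈ evenCenter ℰ := a.2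

@[simp] theorem val_mk (a : E) (ha : a ∈ evenCenter ℰ) : (mk h h₁ a ha).val = a := rfl

@[ext] theorem ext {a b : CenterRing h h₁} (hab : a.val = b.val) : a = b := Subtype.ext hab

instance : AddCommGroup (CenterRing h h₁) := inferInstanceAs (AddCommGroup (evenCenter ℰ))

instance : One (CenterRing h h₁) := ⟨mk h h₁ 1 ⟨h₁, by simp⟩⟩

@[simp] theorem val_zero : (0 : CenterRing h h₁).val = 0 := rfl
@[simp] theorem val_one : (1 : CenterRing h h₁).val = 1 := rfl
@[simp] theorem val_add (a b : CenterRing h h₁) : (a + b).val = a.val + b.val := rfl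
theorem val_commute (a : CenterRing h h₁) (b : E) : a.val * b = b * a.val := a.2.2 b

variable [CharZero Φ]

instance : Mul (CenterRing h h₁) :=
  ⟨fun a b => mk h h₁ _ (h.mul_mem_evenCenter a.val_mem b.val_mem)⟩

@[simp] theorem val_mul (a b : CenterRing h h₁) : (a * b).val = a.val * b.val := rfl

theorem val_mul_mul (a b : CenterRing h h₁) (c : E) : a.val * b.val * c = a.val * (b.val * c) :=
  h.central_mul_mul a.2 b.2 c

instance : CommRing (CenterRing h h₁) where
  __ := (inferInstance : AddCommGroup (CenterRing h h₁))
  left_distrib a b c := by ext; simp [mul_add]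
  right_distrib a b c := by ext; simp [add_mul]
  zero_mul a := by ext; simp
  mul_zero a := by ext; simp
  mul_assoc a b c := by ext; simp [val_mul_mul]
  one_mul a := by ext; simp
  mul_one a := by ext; simp
  mul_comm a b := CenterRing.ext (val_commute a b.val)

instance : Algebra Φ (CenterRing h h₁) :=
  letI : Module Φ (CenterRing h h₁) := inferInstanceAs (Module Φ (evenCenter ℰ))
  Algebra.ofModule (fun r a b => CenterRing.ext (smul_mul_assoc r a.val b.val))
    (fun r a b => CenterRing.ext (mul_smul_comm r a.val b.val))

@[simp] theorem val_smul (r : Φ) (a : CenterRing h h₁) : (r • a).val = r • a.val := rfl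

variable {x : E}

variable (h h₁) in
/-- The derivation `z ↦ ½ (z, x, x)` of the even centre given by an odd element `x`. -/
noncomputable def derivation (hx : x ∈ ℰ 1) : Derivation Φ (CenterRing h h₁) (CenterRing h h₁) :=
  Derivation.mk'
    { toFun := fun a => mk h h₁ ((2⁻¹ : Φ) • associator a.val x x)
        (Submodule.smul_mem _ _ (h.associator_mem_evenCenter a.val_mem hx))
      map_add' := fun a b => by
        ext
        simp only [val_mk, val_add, associator_apply, add_mul]
        module
      map_smul' := fun r a => by
        ext
        simp only [val_mk, val_smul, associator_apply, smul_mul_assoc, RingHom.id_apply]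
        module }
    fun a b => by
      ext
      simp only [LinearMap.coe_mk, AddHom.coe_mk, val_mk, val_mul, val_add, smul_eq_mul,
        mul_smul_comm, h.associator_central_mul b.val_mem a.val_mem hx, smul_add]

theorem val_derivation (hx : x ∈ ℰ 1) (a : CenterRing h h₁) :
    (derivation h h₁ hx a).val = (2⁻¹ : Φ) • associator a.val x x := rfl

variable (h h₁) in
/-- The square of an odd element, as an element of the even centre. -/
def sq (hx : x ∈ ℰ 1) : CenterRing h h₁ := mk h h₁ (x * x) (h.mul_self_mem_evenCenter hx)

@[simp] theorem val_sq (hx : x ∈ ℰ 1) : (sq h h₁ hx).val = x * x := rfl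

theorem val_mul_mul_self (hx : x ∈ ℰ 1) (a : CenterRing h h₁) :
    a.val * x * x = (2 : Φ) • (derivation h h₁ hx a).val + a.val * (x * x) := by
  rw [val_derivation, smul_smul, mul_inv_cancel₀ two_ne_zero, one_smul, associator_apply]
  abel

/-- Write `(ax)(bx) = ((ab)x)x - (ax, b, x)`. The first term is `2 D(ab) + ab x²`, the second is `a
(x, b, x) = a D(b)`. -/
theorem mul_mul_mul (hx : x ∈ ℰ 1) (a b : CenterRing h h₁) :
    a.val * x * (b.val * x) = (a * b * sq h h₁ hx + 2 * derivation h h₁ hx a * b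
      + a * derivation h h₁ hx b).val := by
  have hax : a.val * x * b.val = (a * b).val * x := by
    rw [← val_commute, ← val_mul_mul, ← val_mul, mul_comm]
  have h₂ : associator (a.val * x) b.val x = (a * derivation h h₁ hx b).val := by
    rw [h.associator_mul_central a.val_mem b.val_mem hx, val_mul, val_derivation,
      h.associator_central_left b.val_mem, smul_smul, inv_mul_cancel₀ two_ne_zero, one_smul]
  have h₃ : a.val * x * (b.val * x) = (a * b).val * x * x - associator (a.val * x) b.val x := by
    rw [associator_apply, hax]
    abel
  have h₄ : derivation h h₁ hx (a * b) = a * derivation h h₁ hx b + derivation h h₁ hx a * b := by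
    rw [Derivation.leibniz, smul_eq_mul, smul_eq_mul, mul_comm b]
  have h₅ : (a * b).val * (x * x) = (a * b * sq h h₁ hx).val := by simp
  rw [h₃, val_mul_mul_self hx, h₂, h₄, h₅, two_mul, add_mul]
  simp only [val_add]
  module

variable (h h₁) in
/-- The homomorphism `a + bx ↦ a + bx` to an algebra from the double of its even centre. -/
noncomputable def doubleHom (hx : x ∈ ℰ 1) :
    Double (derivation h h₁ hx) (sq h h₁ hx) →ₙₐ[Φ] E where
  toFun p := p.even.val + p.odd.val * x
  map_smul' r p := by simp [smul_mul_assoc]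
  map_zero' := by simp
  map_add' p q := by
    simp only [Double.even_add, Double.odd_add, val_add, add_mul]
    abel
  map_mul' p q := by
    have h₂ : (sq h h₁ hx) * p.odd * q.odd = p.odd * q.odd * sq h h₁ hx := by ring
    have h₃ : p.odd.val * x * q.even.val = p.odd.val * q.even.val * x := by
      rw [← val_commute, ← val_mul_mul, val_commute]
    rw [add_mul, mul_add, mul_add, mul_mul_mul hx, h₃, ← val_mul_mul, Double.even_mul,
      Double.odd_mul, h₂]
    simp only [val_add, val_mul, add_mul]
    abel

theorem doubleHom_apply (hx : x ∈ ℰ 1) (p : Double (derivation h h₁ hx) (sq h h₁ hx)) :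
    doubleHom h h₁ hx p = p.even.val + p.odd.val * x := rfl

theorem derivation_mul_eq_zero (hx : x ∈ ℰ 1) {b : CenterRing h h₁} (hb : b.val * x = 0)
    (z : CenterRing h h₁) : derivation h h₁ hx z * b = 0 := by
  -- If `cx = 0`, then `(cx)x = 0` and `x(cx) = 0` say `c x² + 2 D c = 0` and `c x² + D c = 0`;
  -- subtract. Applied to `b` and to `zb`, this leaves `b D z = 0` in the Leibniz rule.
  have key : ∀ c : CenterRing h h₁, c.val * x = 0 → derivation h h₁ hx c = 0 := fun c hc => by
    have e₁ := mul_mul_mul hx c 1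
    have e₂ := mul_mul_mul hx 1 c
    rw [hc, zero_mul] at e₁
    rw [hc, mul_zero] at e₂
    have e₁' : c * 1 * sq h h₁ hx + 2 * derivation h h₁ hx c * 1 + c * derivation h h₁ hx 1 = 0 :=
      CenterRing.ext e₁.symm
    have e₂' : 1 * c * sq h h₁ hx + 2 * derivation h h₁ hx 1 * c + 1 * derivation h h₁ hx c = 0 :=
      CenterRing.ext e₂.symm
    rw [Derivation.map_one_eq_zero] at e₁' e₂'
    linear_combination e₁' - e₂'
  have hzb := key (z * b) (by rw [val_mul, val_mul_mul, hb, mul_zero])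
  rw [Derivation.leibniz, key b hb, smul_zero, zero_add, smul_eq_mul] at hzb
  rw [mul_comm, hzb]

end CenterRing

end CenterRing

/-! ### The unital hull -/

section Unitization

variable {Φ A : Type u} [Field Φ] [NonUnitalNonAssocRing A] [Module Φ A]
  {𝒜 : ZMod 2 → Submodule Φ A}

theorem unitization_fst_sub {R M : Type*} [AddGroup R] [AddGroup M] (a b : Unitization R M) :
    (a - b).fst = a.fst - b.fst := rfl

theorem unitization_snd_sub {R M : Type*} [AddGroup R] [AddGroup M] (a b : Unitization R M) :
    (a - b).snd = a.snd - b.snd := rfl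

/-- The grading of the unital hull of a superalgebra, in which the unit is even. -/
def unitizationGrading (𝒜 : ZMod 2 → Submodule Φ A) (i : ZMod 2) :
    Submodule Φ (Unitization Φ A) where
  carrier := {a | (i = 1 → a.fst = 0) ∧ a.snd ∈ 𝒜 i}
  add_mem' ha hb := ⟨fun hi => by simp [ha.1 hi, hb.1 hi], by simpa using add_mem ha.2 hb.2⟩
  zero_mem' := ⟨fun _ => rfl, zero_mem _⟩
  smul_mem' r a ha := ⟨fun hi => by simp [ha.1 hi], by simpa using Submodule.smul_mem _ r ha.2⟩

theorem mem_unitizationGrading {i : ZMod 2} {a : Unitization Φ A} :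
    a ∈ unitizationGrading 𝒜 i ↔ (i = 1 → a.fst = 0) ∧ a.snd ∈ 𝒜 i := Iff.rfl

theorem one_mem_unitizationGrading : (1 : Unitization Φ A) ∈ unitizationGrading 𝒜 0 :=
  ⟨by simp, by simp⟩

theorem inr_mem_unitizationGrading {i : ZMod 2} {a : A} (ha : a ∈ 𝒜 i) :
    (a : Unitization Φ A) ∈ unitizationGrading 𝒜 i := ⟨by simp, by simpa using ha⟩

theorem unitization_superComm {i j : ZMod 2} {a b : Unitization Φ A}
    (ha : a ∈ unitizationGrading 𝒜 i) (hb : b ∈ unitizationGrading 𝒜 j) :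
    superComm i j a b = (superComm i j a.snd b.snd : A) := by
  rw [mem_unitizationGrading] at ha hb
  rcases zmod_two_cases i with rfl | rfl <;> rcases zmod_two_cases j with rfl | rfl <;>
    ext <;> simp_all [superComm, unitization_fst_sub, unitization_snd_sub, mul_comm]
  module

theorem exists_inr_of_fst_eq_zero {i : ZMod 2} {a : Unitization Φ A}
    (ha : a ∈ unitizationGrading 𝒜 i) (h₀ : a.fst = 0) : ∃ b ∈ 𝒜 i, (b : Unitization Φ A) = a :=
  ⟨a.snd, ha.2, by ext <;> simp [h₀]⟩

variable [IsScalarTower Φ A A] [SMulCommClass Φ A A]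

/-- Scalars associate with everything, so only the components in `A` contribute. -/
theorem unitization_associator (a b c : Unitization Φ A) :
    associator a b c = (associator a.snd b.snd c.snd : A) := by
  ext
  · simp [associator_apply, mul_assoc, unitization_fst_sub]
  · simp only [associator_apply, unitization_snd_sub, Unitization.snd_mul, Unitization.fst_mul,
      Unitization.snd_inr, add_mul, mul_add, smul_mul_assoc, mul_smul_comm]
    module

theorem HasStronglyIdentities.unitization (h : HasStronglyIdentities 𝒜) :
    HasStronglyIdentities (unitizationGrading 𝒜) where
  codisjoint := by
    rw [codisjoint_iff, eq_top_iff]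
    intro a _
    obtain ⟨a₀, h₀, a₁, h₁, ha⟩ := h.exists_add a.snd
    have : a = (Unitization.inl a.fst + (a₀ : Unitization Φ A)) + (a₁ : Unitization Φ A) := by
      ext <;> simp [ha]
    rw [this]
    exact Submodule.add_mem_sup ⟨by simp, by simpa using h₀⟩ ⟨by simp, by simpa using h₁⟩
  mul_mem {i j a b} ha hb := by
    have hab := h.mul_mem ha.2 hb.2
    rw [mem_unitizationGrading] at *
    rcases zmod_two_cases i with rfl | rfl <;> rcases zmod_two_cases j with rfl | rfl <;>
      simp_all
    · exact add_mem (add_mem (Submodule.smul_mem _ _ hb) (Submodule.smul_mem _ _ ha)) hab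
    · exact add_mem (Submodule.smul_mem _ _ hb.2) hab
    · exact add_mem (Submodule.smul_mem _ _ ha.2) hab
  right_alternative ha hb hc := by
    have := congrArg (Unitization.inr : A → Unitization Φ A) (h.right_alternative ha.2 hb.2 hc.2)
    simpa only [unitization_associator, Unitization.inr_add, Unitization.inr_smul,
      Unitization.inr_zero] using this
  cyclic ha hb hc := by
    have := congrArg (Unitization.inr : A → Unitization Φ A) (h.cyclic ha.2 hb.2 hc.2)
    simpa only [unitization_associator, Unitization.inr_add, Unitization.inr_smul,
      Unitization.inr_zero] using this
  comm_comm {i j k a b c} ha hb hc := by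
    have hab : superComm i j a.snd b.snd ∈ 𝒜 (i + j) := by
      have h₂ := h.mul_mem hb.2 ha.2
      rw [add_comm] at h₂
      exact sub_mem (h.mul_mem ha.2 hb.2) (zsmul_mem h₂ _)
    rw [unitization_superComm ha hb, unitization_superComm (inr_mem_unitizationGrading hab) hc]
    simp [h.comm_comm ha.2 hb.2 hc.2]

end Unitization

open Polynomial

/-! ### Polynomials over a differential algebra -/

section PolynomialFamilies

variable {Φ S S' : Type u} [Field Φ] [CommRing S] [Algebra Φ S] [CommRing S'] [Algebra Φ S']

/-- `S` may have zero divisors, so roots cannot be counted in `S`. Applying a `Φ`-linear functional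
to the coefficients gives a polynomial over `Φ` with infinitely many roots, and functionals separate
the points of `S`. -/
theorem polynomial_eq_zero_of_infinite (p : S[X]) {T : Set Φ} (hT : T.Infinite)
    (hp : ∀ c ∈ T, p.eval (algebraMap Φ S c) = 0) : p = 0 := by
  ext i
  rw [coeff_zero, ← Module.forall_dual_apply_eq_zero_iff Φ]
  intro l
  have hq : (∑ n ∈ p.support, monomial n (l (p.coeff n)) : Φ[X]) = 0 := by
    refine eq_zero_of_infinite_isRoot _ (hT.mono fun c hc => ?_)
    have h₁ := congrArg l (hp c hc)
    rw [eval_eq_sum, Polynomial.sum, map_sum, map_zero] at h₁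
    rw [Set.mem_ofPred_eq, IsRoot, eval_finsetSum, ← h₁]
    refine Finset.sum_congr rfl fun n _ => ?_
    rw [eval_monomial, ← map_pow, mul_comm (p.coeff n), ← Algebra.smul_def, map_smul, smul_eq_mul,
      mul_comm]
  by_cases hi : i ∈ p.support
  · have h₂ := congrArg (coeff · i) hq
    simpa [finsetSum_coeff, coeff_monomial, Finset.sum_ite_eq', hi] using h₂
  · rw [notMem_support_iff.1 hi, map_zero]

theorem algHom_comp_derivation {Δ : Derivation Φ S[X] S[X]} {D' : Derivation Φ S' S'}
    (g : S[X] →ₐ[Φ] S') (hC : ∀ a, g (Δ (C a)) = D' (g (C a))) (hX : g (Δ X) = D' (g X))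
    (p : S[X]) :
    g (Δ p) = D' (g p) := by
  induction p using Polynomial.induction_on with
  | C a => exact hC a
  | add p q hp hq => simp [hp, hq]
  | monomial n a h =>
    rw [pow_succ, ← mul_assoc]
    generalize C a * X ^ n = q at h
    simp only [Derivation.leibniz, smul_eq_mul, map_add, map_mul, h, hX]

/-- The derivation acting on the coefficients of polynomials. -/
noncomputable def coeffDerivation (D : Derivation Φ S S) : Derivation Φ S[X] S[X] :=
  (PolynomialModule.equivPolynomialSelf (R := S)).toLinearMap.compDer D.mapCoeffs

@[simp] theorem coeffDerivation_C (D : Derivation Φ S S) (a : S) :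
    coeffDerivation D (C a) = C (D a) := by
  rw [← monomial_zero_left]
  simp [coeffDerivation]

@[simp] theorem coeffDerivation_X (D : Derivation Φ S S) : coeffDerivation D (X : S[X]) = 0 := by
  rw [← monomial_one_one_eq_X]
  simp [coeffDerivation]

/-- The derivation `t d/dy` of `S[y]`. -/
noncomputable def scaledDerivative (Φ : Type u) [Field Φ] [Algebra Φ S] (t : S) :
    Derivation Φ S[X] S[X] := (C t : S[X]) • (derivative' (R := S)).restrictScalars Φ

@[simp] theorem scaledDerivative_C (t a : S) : scaledDerivative Φ t (C a) = 0 := by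
  simp [scaledDerivative]

@[simp] theorem scaledDerivative_X (t : S) : scaledDerivative Φ t X = C t := by
  simp [scaledDerivative]

end PolynomialFamilies

/-! ### Specialization and limits of values of nonassociative polynomials -/

section Transfer

variable {Φ S R : Type u} {ι : Type} [Field Φ] [CommRing S] [Algebra Φ S] [CommRing R] [Algebra Φ R]

theorem map_lift {A B : Type u} [NonUnitalNonAssocRing A] [Module Φ A]
    [IsScalarTower Φ A A] [SMulCommClass Φ A A] [NonUnitalNonAssocRing B] [Module Φ B]
    [IsScalarTower Φ B B] [SMulCommClass Φ B B] (φ : A →ₙₐ[Φ] B) (v : ι → A)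
    (f : FreeNonUnitalNonAssocAlgebra Φ ι) :
    φ (FreeNonUnitalNonAssocAlgebra.lift Φ v f) =
      FreeNonUnitalNonAssocAlgebra.lift Φ (fun q => φ (v q)) f := by
  have : φ.comp (FreeNonUnitalNonAssocAlgebra.lift Φ v) =
      FreeNonUnitalNonAssocAlgebra.lift Φ (fun q => φ (v q)) := by
    refine FreeNonUnitalNonAssocAlgebra.hom_ext _ fun q => ?_
    simp
  exact DFunLike.congr_fun this f

/-- The value of a polynomial on a family of elements `aᵢ + bᵢx` of `S ⊕ Sx`. -/
noncomputable def doubleEval (D : Derivation Φ S S) (γ : S) (v : ι → S × S)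
    (f : FreeNonUnitalNonAssocAlgebra Φ ι) : Double D γ :=
  FreeNonUnitalNonAssocAlgebra.lift Φ (fun q => Double.mk (v q).1 (v q).2) f

theorem map_doubleEval {D : Derivation Φ S S} {γ : S} {D' : Derivation Φ R R} {γ' : R}
    (g : S →ₐ[Φ] R) (hD : ∀ s, g (D s) = D' (g s)) (hγ : g γ = γ') (v : ι → S × S)
    (f : FreeNonUnitalNonAssocAlgebra Φ ι) :
    Double.map g hD hγ (doubleEval D γ v f) =
      doubleEval D' γ' (fun q => (g (v q).1, g (v q).2)) f :=
  map_lift _ _ _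

theorem scale_doubleEval {D : Derivation Φ S S} {γ : S} (c : Φ) (v : ι → S × S)
    (f : FreeNonUnitalNonAssocAlgebra Φ ι) :
    Double.scale c (doubleEval (c ^ 2 • D) (c ^ 2 • γ) v f) =
      doubleEval D γ (fun q => ((v q).1, c • (v q).2)) f :=
  map_lift _ _ _

/-- If a polynomial vanishes on all multiples `v c e` of a family `v` by a constant `e` of a
differential domain, then it vanishes on `v`. -/
theorem doubleEval_eq_zero_of_smul [CharZero Φ] [IsDomain S] {D : Derivation Φ S S} {γ e : S}
    (he : e ≠ 0) (hDe : D e = 0) {v : ι → S × S} {f : FreeNonUnitalNonAssocAlgebra Φ ι}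
    (hf : ∀ c : Φ, doubleEval D γ (fun q => ((v q).1 * c • e, (v q).2 * c • e)) f = 0) :
    doubleEval D γ v f = 0 := by
  -- The value on the generic multiple `vX`. Since `X` is a constant of the derivation, `X ↦ s` is a
  -- differential homomorphism whenever `D s = 0`: the values `c • e` show `p = 0`, and `s = 1`
  -- recovers `v`.
  set p := doubleEval (coeffDerivation D) (C γ)
    (fun q => ((C (v q).1 * X, C (v q).2 * X) : S[X] × S[X])) f with hp
  have ev : ∀ s : S, D s = 0 → ∃ (hD : _) (hγ : _),
      Double.map (D' := D) (γ' := γ) ((aeval s : S[X] →ₐ[S] S).restrictScalars Φ) hD hγ p =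
        doubleEval D γ (fun q => ((v q).1 * s, (v q).2 * s)) f := fun s hs =>
    ⟨algHom_comp_derivation _ (by simp) (by simp [hs]), by simp, by
      rw [hp, map_doubleEval]
      simp⟩
  have inj : ∀ r : S[X], (∀ c : Φ, aeval (c • e) r = 0) → r = 0 := fun r hr => by
    refine eq_zero_of_infinite_isRoot _ ((Set.infinite_range_of_injective
      (f := fun c : Φ => c • e) (smul_left_injective Φ he)).mono ?_)
    rintro _ ⟨c, rfl⟩
    simpa [IsRoot, aeval_def] using hr c
  have hp0 : p = 0 := by
    have h₁ := fun c : Φ => ev (c • e) (by simp [hDe])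
    refine Double.ext ?_ ?_
    · refine inj _ fun c => ?_
      obtain ⟨hD, hγ, h₂⟩ := h₁ c
      rw [hf c] at h₂
      simpa using congrArg Double.even h₂
    · refine inj _ fun c => ?_
      obtain ⟨hD, hγ, h₂⟩ := h₁ c
      rw [hf c] at h₂
      simpa using congrArg Double.odd h₂
  obtain ⟨hD, hγ, h₁⟩ := ev 1 (by simp)
  rw [hp0, map_zero] at h₁
  simpa using h₁.symm

/-- Passage to the limit `e → 0` in the family of doubles with derivation `D₂ + e D₁` and
`x² = e γ`. -/
theorem doubleEval_limit {D₁ D₂ : Derivation Φ S S} {γ s : S} {v : ι → S × S}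
    {f : FreeNonUnitalNonAssocAlgebra Φ ι} {T : Set Φ} (hT : T.Infinite)
    (hf : ∀ c ∈ T, (doubleEval (c • D₁ + D₂) (c • γ) v f).even = 0 ∧
      s * (doubleEval (c • D₁ + D₂) (c • γ) v f).odd = 0) :
    (doubleEval D₂ 0 v f).even = 0 ∧ s * (doubleEval D₂ 0 v f).odd = 0 := by
  -- Here `X` is the deformation parameter. It is a constant of the derivation, so it may be
  -- specialized to `c ∈ T` and to `0`.
  set p := doubleEval ((X : S[X]) • coeffDerivation D₁ + coeffDerivation D₂) (X * C γ)
    (fun q => ((C (v q).1, C (v q).2) : S[X] × S[X])) f with hp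
  have ev : ∀ (c : Φ) (D' : Derivation Φ S S) (γ' : S), D' = c • D₁ + D₂ → γ' = c • γ →
      aeval (algebraMap Φ S c) p.even = (doubleEval D' γ' v f).even ∧
      aeval (algebraMap Φ S c) p.odd = (doubleEval D' γ' v f).odd := by
    rintro c _ _ rfl rfl
    have h₁ := map_doubleEval (D := (X : S[X]) • coeffDerivation D₁ + coeffDerivation D₂)
      (γ := X * C γ) (D' := c • D₁ + D₂) (γ' := c • γ)
      ((aeval (algebraMap Φ S c) : S[X] →ₐ[S] S).restrictScalars Φ)
      (algHom_comp_derivation _ (by simp [Algebra.smul_def, Algebra.commutes]) (by simp))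
      (by simp [Algebra.smul_def, Algebra.commutes])
      (fun q => ((C (v q).1, C (v q).2) : S[X] × S[X])) f
    rw [← hp] at h₁
    simp only [AlgHom.coe_restrictScalars', aeval_C, Algebra.algebraMap_self, RingHom.id_apply]
      at h₁
    exact ⟨congrArg Double.even h₁, congrArg Double.odd h₁⟩
  have h₀ : p.even = 0 := polynomial_eq_zero_of_infinite _ hT fun c hc => by
    rw [← coe_aeval_eq_eval, (ev c _ _ rfl rfl).1, (hf c hc).1]
  have h₁ : C s * p.odd = 0 := polynomial_eq_zero_of_infinite _ hT fun c hc => by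
    rw [eval_mul, eval_C, ← coe_aeval_eq_eval, (ev c _ _ rfl rfl).2, (hf c hc).2]
  obtain ⟨h₂, h₃⟩ := ev 0 D₂ 0 (by simp) (by simp)
  refine ⟨by rw [← h₂, h₀, map_zero], ?_⟩
  have h₄ := congrArg (aeval (algebraMap Φ S 0)) h₁
  rwa [map_mul, h₃, aeval_C, map_zero] at h₄

/-- A single value of `y` would not determine `p`. All shifts by constants `u` do: they give
infinitely many roots of `p` composed with an affine substitution that is invertible over `R`. -/
theorem polynomial_eq_zero_of_shift [CharZero Φ] {e : Φ} (he : e ≠ 0) (z : R) {p : R[X]}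
    (hp : ∀ u : Φ, aeval (e⁻¹ • (z + algebraMap Φ R u)) p = 0) : p = 0 := by
  have h₁ : p.comp (C (algebraMap Φ R e⁻¹) * (C z + X)) = 0 := by
    refine polynomial_eq_zero_of_infinite (Φ := Φ) _ Set.infinite_univ fun u _ => ?_
    rw [eval_comp, ← hp u, coe_aeval_eq_eval]
    simp [Algebra.smul_def]
  have h₂ : p = (p.comp (C (algebraMap Φ R e⁻¹) * (C z + X))).comp
      (C (algebraMap Φ R e) * X - C z) := by
    rw [comp_assoc]
    simp only [mul_comp, add_comp, C_comp, X_comp, add_sub_cancel, ← mul_assoc, ← map_mul,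
      inv_mul_cancel₀ he, map_one, one_mul, comp_X]
  rw [h₂, h₁, zero_comp]

/-- Since `D w = c⁻² D z`, the evaluation `y ↦ w` carries `c² D + D z · d/dy` to `c² D`; then
`Double.scale` trades the factor `c²` for `x ↦ cx`. -/
theorem doubleEval_specialization {D : Derivation Φ R R} {γ : R} (z : R) {c : Φ} (hc : c ≠ 0)
    (u : Φ) (v : ι → R[X] × R[X]) (f : FreeNonUnitalNonAssocAlgebra Φ ι) :
    let w := (c ^ 2)⁻¹ • (z + algebraMap Φ R u)
    let p := doubleEval (c ^ 2 • coeffDerivation D + scaledDerivative Φ (D z)) (c ^ 2 • C γ) v f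
    let p' := doubleEval D γ (fun q => (aeval w (v q).1, c • aeval w (v q).2)) f
    aeval w p.even = p'.even ∧ c • aeval w p.odd = p'.odd := by
  intro w p p'
  have h₁ := map_doubleEval (D := c ^ 2 • coeffDerivation D + scaledDerivative Φ (D z))
    (γ := c ^ 2 • C γ) (D' := c ^ 2 • D) (γ' := c ^ 2 • γ)
    ((aeval w : R[X] →ₐ[R] R).restrictScalars Φ)
    (algHom_comp_derivation _ (by simp) (by simp [w, hc])) (by simp) v f
  have h₂ := (congrArg (Double.scale c) h₁).trans (scale_doubleEval c _ f)
  exact ⟨congrArg Double.even h₂, congrArg Double.odd h₂⟩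

/-- If a polynomial vanishes on the specializations `y ↦ (z + u) / c²` in a differential algebra,
for all constants `u` and `c ≠ 0`, then it vanishes after replacing `D` by `D z · d/dy`. -/
theorem doubleEval_scaledDerivative [CharZero Φ] {D : Derivation Φ R R} {γ s : R} (z : R)
    {v : ι → R[X] × R[X]} {f : FreeNonUnitalNonAssocAlgebra Φ ι}
    (hf : ∀ c u : Φ, c ≠ 0 → ∀ w, w = (c ^ 2)⁻¹ • (z + algebraMap Φ R u) →
      (doubleEval D γ (fun q => (aeval w (v q).1, c • aeval w (v q).2)) f).even = 0 ∧
      s * (doubleEval D γ (fun q => (aeval w (v q).1, c • aeval w (v q).2)) f).odd = 0) :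
    (doubleEval (scaledDerivative Φ (D z)) 0 v f).even = 0 ∧
      C s * (doubleEval (scaledDerivative Φ (D z)) 0 v f).odd = 0 := by
  -- The parameter enters as `c²` with `c ≠ 0`, so the limit is taken along squares of positive
  -- integers.
  have hT : (Set.range fun n : ℕ => ((n : Φ) + 1) ^ 2).Infinite := by
    refine Set.infinite_range_of_injective fun m n hmn => ?_
    have : (m + 1) ^ 2 = (n + 1) ^ 2 := by exact_mod_cast hmn
    simpa using Nat.pow_left_injective two_ne_zero this
  refine doubleEval_limit (D₁ := coeffDerivation D) (γ := C γ) hT ?_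
  rintro _ ⟨n, rfl⟩
  beta_reduce
  have hc : (n : Φ) + 1 ≠ 0 := Nat.cast_add_one_ne_zero n
  generalize (n : Φ) + 1 = c at hc
  refine ⟨polynomial_eq_zero_of_shift (pow_ne_zero 2 hc) z fun u => ?_,
    polynomial_eq_zero_of_shift (pow_ne_zero 2 hc) z fun u => ?_⟩
  · rw [(doubleEval_specialization z hc u v f).1, (hf c u hc _ rfl).1]
  · have h₁ := (hf c u hc _ rfl).2
    rw [← (doubleEval_specialization z hc u v f).2, mul_smul_comm] at h₁
    rw [map_mul, aeval_C]
    exact (smul_eq_zero.1 h₁).resolve_left hc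

end Transfer

/-! ### Homomorphisms and quotient algebras -/

section Homomorphisms

variable {Φ A B : Type u} [Field Φ] [NonUnitalNonAssocRing A] [Module Φ A]
  [NonUnitalNonAssocRing B] [Module Φ B]

theorem map_associator (φ : A →ₙₐ[Φ] B) (a b c : A) :
    φ (associator a b c) = associator (φ a) (φ b) (φ c) := by
  simp [associator_apply]

theorem map_superComm (φ : A →ₙₐ[Φ] B) (i j : ZMod 2) (a b : A) :
    φ (superComm i j a b) = superComm i j (φ a) (φ b) := by
  simp [superComm]

theorem map_leftPow (φ : A →ₙₐ[Φ] B) (a : A) : ∀ k, φ (leftPow a k) = leftPow (φ a) k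
  | 0 => map_zero φ
  | 1 => rfl
  | k + 2 => by rw [leftPow, leftPow, map_mul, map_leftPow φ a (k + 1)]

variable (Φ) in
/-- The quotient map by the ideal generated by a set. -/
def idealMk (S : Set A) : A →ₙₐ[Φ] IdealQuotient Φ S where
  toFun := Submodule.Quotient.mk
  map_smul' _ _ := rfl
  map_zero' := rfl
  map_add' _ _ := rfl
  map_mul' _ _ := rfl

theorem idealMk_eq_zero {S : Set A} {a : A} (ha : a ∈ S) : idealMk Φ S a = 0 :=
  (Submodule.Quotient.mk_eq_zero _).2 (subset_idealSpan Φ S ha)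

theorem idealMk_surjective (S : Set A) : Function.Surjective (idealMk Φ S) :=
  Submodule.Quotient.mk_surjective _

theorem map_eq_zero_of_mem_idealSpan {S : Set A} (φ : A →ₙₐ[Φ] B) (hφ : ∀ a ∈ S, φ a = 0) {a : A}
    (ha : a ∈ idealSpan Φ S) : φ a = 0 := by
  let I : Submodule Φ A :=
    { carrier := {a | φ a = 0}
      add_mem' := fun {a b} ha hb => by
        rw [Set.mem_ofPred_eq] at *
        rw [map_add, ha, hb, add_zero]
      zero_mem' := map_zero φ
      smul_mem' := fun r a ha => by
        rw [Set.mem_ofPred_eq] at *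
        rw [map_smul, ha, smul_zero] }
  have hI : IsIdeal Φ I := fun a (ha : φ a = 0) b => by
    refine ⟨?_, ?_⟩
    · change φ (a * b) = 0
      rw [map_mul, ha, zero_mul]
    · change φ (b * a) = 0
      rw [map_mul, ha, mul_zero]
  exact idealSpan_le Φ hI hφ ha

/-- The homomorphism from a quotient algebra induced by a homomorphism that kills the relators. -/
def idealLift {S : Set A} (φ : A →ₙₐ[Φ] B) (hφ : ∀ a ∈ S, φ a = 0) :
    IdealQuotient Φ S →ₙₐ[Φ] B where
  toFun := Quotient.lift φ fun a b hab => by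
    have h₁ := map_eq_zero_of_mem_idealSpan φ hφ ((Submodule.quotientRel_def _).1 hab)
    rwa [map_sub, sub_eq_zero] at h₁
  map_smul' := by
    rintro r ⟨a⟩
    exact map_smul φ r a
  map_zero' := map_zero φ
  map_add' := by
    rintro ⟨a⟩ ⟨b⟩
    exact map_add φ a b
  map_mul' := by
    rintro ⟨a⟩ ⟨b⟩
    exact map_mul φ a b

end Homomorphisms

/-! ### The grading of the free algebra -/

section FreeGrading

variable {Φ A : Type u} {X : Type} [Field Φ] [NonUnitalNonAssocRing A] [Module Φ A]

theorem freeGrading_eq_span (p : X → ZMod 2) (i : ZMod 2) : freeGrading Φ p i =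
    Submodule.span Φ ((fun w => MonoidAlgebra.single w 1) '' {w | monomialParity p w = i}) :=
  MonoidAlgebra.supported_eq_span_single ..

theorem map_mem_of_mem_freeGrading {𝒜 : ZMod 2 → Submodule Φ A} {p : X → ZMod 2}
    (hmul : ∀ {i j : ZMod 2} {a b : A}, a ∈ 𝒜 i → b ∈ 𝒜 j → a * b ∈ 𝒜 (i + j))
    (φ : FreeNonUnitalNonAssocAlgebra Φ X →ₙₐ[Φ] A)
    (hφ : ∀ q, φ (FreeNonUnitalNonAssocAlgebra.of Φ q) ∈ 𝒜 (p q)) {i : ZMod 2}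
    {a : FreeNonUnitalNonAssocAlgebra Φ X} (ha : a ∈ freeGrading Φ p i) : φ a ∈ 𝒜 i := by
  have hmono : ∀ w : FreeMagma X, φ (MonoidAlgebra.single w 1) ∈ 𝒜 (monomialParity p w) := by
    intro w
    induction w with
    | ih1 q => exact hφ q
    | ih2 v w hv hw =>
      have : (MonoidAlgebra.single (v * w) 1 : FreeNonUnitalNonAssocAlgebra Φ X) =
          MonoidAlgebra.single v 1 * MonoidAlgebra.single w 1 := by
        rw [MonoidAlgebra.single_mul_single, one_mul]
      rw [this, map_mul]
      exact hmul hv hw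
  rw [freeGrading_eq_span] at ha
  induction ha using Submodule.span_induction with
  | mem a ha =>
    obtain ⟨w, rfl, rfl⟩ := ha
    exact hmono w
  | zero => rw [map_zero]; exact zero_mem _
  | add a b _ _ ha hb => rw [map_add]; exact add_mem ha hb
  | smul r a _ ha => rw [map_smul]; exact Submodule.smul_mem _ r ha

theorem freeGrading_mul_mem (p : X → ZMod 2) {i j : ZMod 2}
    {a b : FreeNonUnitalNonAssocAlgebra Φ X} (ha : a ∈ freeGrading Φ p i)
    (hb : b ∈ freeGrading Φ p j) : a * b ∈ freeGrading Φ p (i + j) := by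
  rw [freeGrading_eq_span] at ha hb
  induction ha, hb using Submodule.span_induction₂ with
  | mem_mem a b ha hb =>
    obtain ⟨v, rfl, rfl⟩ := ha
    obtain ⟨w, rfl, rfl⟩ := hb
    rw [MonoidAlgebra.single_mul_single, one_mul, freeGrading_eq_span]
    exact Submodule.subset_span ⟨_, rfl, rfl⟩
  | zero_left b _ => rw [zero_mul]; exact zero_mem _
  | zero_right a _ => rw [mul_zero]; exact zero_mem _
  | add_left a a' b _ _ _ h h' => rw [add_mul]; exact add_mem h h'
  | add_right a b b' _ _ _ h h' => rw [mul_add]; exact add_mem h h'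
  | smul_left r a b _ _ h => rw [smul_mul_assoc]; exact Submodule.smul_mem _ r h
  | smul_right r a b _ _ h => rw [mul_smul_comm]; exact Submodule.smul_mem _ r h

theorem of_mem_freeGrading (p : X → ZMod 2) (q : X) :
    FreeNonUnitalNonAssocAlgebra.of Φ q ∈ freeGrading Φ p (p q) := by
  rw [freeGrading_eq_span]
  exact Submodule.subset_span ⟨FreeMagma.of q, rfl, rfl⟩

theorem freeGrading_codisjoint (p : X → ZMod 2) :
    Codisjoint (freeGrading Φ p 0) (freeGrading Φ p 1) := by
  rw [codisjoint_iff, freeGrading_eq_span, freeGrading_eq_span, ← Submodule.span_union,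
    ← Set.image_union]
  have : {w | monomialParity p w = 0} ∪ {w | monomialParity p w = 1} = Set.univ :=
    Set.eq_univ_of_forall fun w => zmod_two_cases _
  rw [this, ← MonoidAlgebra.supported_eq_span_single, eq_top_iff]
  exact fun a _ => Set.subset_univ _

end FreeGrading

/-! ### The map from `F₀` to its model -/

section ModelOfF0

variable (Φ : Type u) [Field Φ]

/-- The derivation `T ∂/∂Z` of `Φ[T][Z]`. -/
noncomputable abbrev modelDerivation : Derivation Φ Φ[X][X] Φ[X][X] := scaledDerivative Φ X

/-- The double of `Φ[T][Z]` with `D = T ∂/∂Z` and `x² = 0`, which contains `F₀`. -/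
abbrev Model : Type u := Double (modelDerivation Φ) 0

/-- The images of the generators of `F₀`. -/
noncomputable def modelGen : Gen → Model Φ
  | .z => Double.mk X 0
  | .x => Double.mk 0 1

/-- The homomorphism from the free algebra to the model of `F₀`. -/
noncomputable def freeToModel : FreeZX Φ →ₙₐ[Φ] Model Φ :=
  FreeNonUnitalNonAssocAlgebra.lift Φ (modelGen Φ)

@[simp] theorem freeToModel_genZ : freeToModel Φ (genZ Φ) = Double.mk X 0 :=
  FreeNonUnitalNonAssocAlgebra.lift_of_apply ..

@[simp] theorem freeToModel_genX : freeToModel Φ (genX Φ) = Double.mk 0 1 :=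
  FreeNonUnitalNonAssocAlgebra.lift_of_apply ..

theorem freeToModel_mem {i : ZMod 2} {a : FreeZX Φ} (ha : a ∈ freeGrading Φ Gen.parity i) :
    freeToModel Φ a ∈ Double.grading (modelDerivation Φ) 0 i := by
  refine map_mem_of_mem_freeGrading (Double.hasStronglyIdentities _ _).mul_mem _ ?_ ha
  rintro (_ | _)
  · change freeToModel Φ (genZ Φ) ∈ Double.grading (modelDerivation Φ) 0 0
    simp
  · change freeToModel Φ (genX Φ) ∈ Double.grading (modelDerivation Φ) 0 1
    simp

theorem model_associator :
    associator (Double.mk X 0) (Double.mk 0 1) (Double.mk 0 1) =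
      (Double.mk (2 * C X) 0 : Model Φ) := by
  ext1 <;> simp [associator_apply]

theorem freeToModel_relator {r : FreeZX Φ} (hr : F0Relator Φ r) : freeToModel Φ r = 0 := by
  have h := Double.hasStronglyIdentities (modelDerivation Φ) 0
  cases hr with
  | right_alternative ha hb hc =>
    simpa [map_associator] using
      h.right_alternative (freeToModel_mem Φ ha) (freeToModel_mem Φ hb) (freeToModel_mem Φ hc)
  | cyclic ha hb hc =>
    simpa [map_associator] using
      h.cyclic (freeToModel_mem Φ ha) (freeToModel_mem Φ hb) (freeToModel_mem Φ hc)
  | comm_comm ha hb hc =>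
    simpa [map_superComm] using
      h.comm_comm (freeToModel_mem Φ ha) (freeToModel_mem Φ hb) (freeToModel_mem Φ hc)
  | central f => refine Double.ext ?_ ?_ <;> simp [mul_comm]
  | x_sq => refine Double.ext ?_ ?_ <;> simp
  | zxx =>
    rw [map_associator, map_associator, freeToModel_genX, freeToModel_genZ, model_associator]
    have h₂ : modelDerivation Φ 2 = 0 := by exact_mod_cast (modelDerivation Φ).map_natCast 2
    refine Double.ext ?_ ?_ <;> simp [associator_apply, h₂]

/-- The homomorphism from `F₀` to its model. -/
noncomputable def toModel : F0 Φ →ₙₐ[Φ] Model Φ :=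
  idealLift (freeToModel Φ) fun _ hr => freeToModel_relator Φ hr

/-- The projection of the free algebra onto `F₀`. -/
noncomputable abbrev toF0 : FreeZX Φ →ₙₐ[Φ] F0 Φ := idealMk Φ {r : FreeZX Φ | F0Relator Φ r}

@[simp] theorem toModel_toF0 (a : FreeZX Φ) : toModel Φ (toF0 Φ a) = freeToModel Φ a := rfl

theorem mem_F0grading {i : ZMod 2} {a : F0 Φ} :
    a ∈ F0grading Φ i ↔ ∃ b ∈ freeGrading Φ Gen.parity i, toF0 Φ b = a := Iff.rfl

theorem toModel_mem {i : ZMod 2} {a : F0 Φ} (ha : a ∈ F0grading Φ i) :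
    toModel Φ a ∈ Double.grading (modelDerivation Φ) 0 i := by
  obtain ⟨b, hb, rfl⟩ := (mem_F0grading Φ).1 ha
  exact freeToModel_mem Φ hb

/-- Directness of the grading is left out: it follows only once `F₀` is known to embed in the model,
and the embedding uses these identities. -/
theorem F0_hasStronglyIdentities : HasStronglyIdentities (F0grading Φ) where
  codisjoint := by
    rw [codisjoint_iff, eq_top_iff]
    intro a _
    obtain ⟨b, rfl⟩ := idealMk_surjective _ a
    obtain ⟨b₀, h₀, b₁, h₁, rfl⟩ := Submodule.mem_sup.1
      ((freeGrading_codisjoint (Φ := Φ) Gen.parity).eq_top ▸ Submodule.mem_top (x := b))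
    rw [map_add]
    exact Submodule.add_mem_sup ⟨b₀, h₀, rfl⟩ ⟨b₁, h₁, rfl⟩
  mul_mem := by
    rintro i j _ _ ⟨a, ha, rfl⟩ ⟨b, hb, rfl⟩
    exact ⟨a * b, freeGrading_mul_mem _ ha hb, rfl⟩
  right_alternative {i j k _ _ _} := by
    rintro ⟨a, ha, rfl⟩ ⟨b, hb, rfl⟩ ⟨c, hc, rfl⟩
    have h : toF0 Φ _ = 0 := idealMk_eq_zero (F0Relator.right_alternative ha hb hc)
    simp only [map_add, map_zsmul, map_associator] at h
    exact h
  cyclic := by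
    rintro i j k _ _ _ ⟨a, ha, rfl⟩ ⟨b, hb, rfl⟩ ⟨c, hc, rfl⟩
    have h : toF0 Φ _ = 0 := idealMk_eq_zero (F0Relator.cyclic ha hb hc)
    simp only [map_add, map_zsmul, map_associator] at h
    exact h
  comm_comm := by
    rintro i j k _ _ _ ⟨a, ha, rfl⟩ ⟨b, hb, rfl⟩ ⟨c, hc, rfl⟩
    have h : toF0 Φ _ = 0 := idealMk_eq_zero (F0Relator.comm_comm ha hb hc)
    simp only [map_superComm] at h
    exact h

theorem toF0_genZ_mem : toF0 Φ (genZ Φ) ∈ evenCenter (F0grading Φ) := by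
  refine ⟨⟨genZ Φ, of_mem_freeGrading Gen.parity Gen.z, rfl⟩, fun a => ?_⟩
  obtain ⟨a, rfl⟩ := idealMk_surjective _ a
  rw [← sub_eq_zero, ← map_mul, ← map_mul, ← map_sub]
  exact idealMk_eq_zero (F0Relator.central a)

theorem toF0_genX_mem : toF0 Φ (genX Φ) ∈ F0grading Φ 1 :=
  ⟨genX Φ, of_mem_freeGrading Gen.parity Gen.x, rfl⟩

end ModelOfF0

/-! ### The even centre of the unital hull -/

section CenterOfUnitization

variable {Φ A : Type u} [Field Φ] [NonUnitalNonAssocRing A] [Module Φ A]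
  [IsScalarTower Φ A A] [SMulCommClass Φ A A] {𝒜 : ZMod 2 → Submodule Φ A}

instance : IsScalarTower Φ (Unitization Φ A) (Unitization Φ A) where
  smul_assoc r a b := by
    ext
    · simp [mul_assoc]
    · simp only [smul_eq_mul, Unitization.snd_mul, Unitization.snd_smul, Unitization.fst_smul,
        smul_mul_assoc]
      module

instance : SMulCommClass Φ (Unitization Φ A) (Unitization Φ A) where
  smul_comm r a b := by
    ext
    · simp [mul_left_comm]
    · simp only [smul_eq_mul, Unitization.snd_mul, Unitization.snd_smul, Unitization.fst_smul,
        mul_smul_comm]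
      module

variable (Φ A) in
/-- The embedding into the unital hull. -/
def hullHom : A →ₙₐ[Φ] Unitization Φ A where
  toFun := Unitization.inr
  map_smul' r a := Unitization.inr_smul Φ r a
  map_zero' := Unitization.inr_zero Φ
  map_add' a b := Unitization.inr_add Φ a b
  map_mul' a b := Unitization.inr_mul Φ a b

theorem inr_mem_evenCenter {z : A} (hz : z ∈ evenCenter 𝒜) :
    (z : Unitization Φ A) ∈ evenCenter (unitizationGrading 𝒜) := by
  refine ⟨inr_mem_unitizationGrading hz.1, fun b => ?_⟩
  ext
  · simp
  · simp [hz.2]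

variable [CharZero Φ]

/-- The even centre of the unital hull of a strongly (-1,1)-superalgebra. -/
abbrev HullCenter (h : HasStronglyIdentities 𝒜) : Type u :=
  CenterRing h.unitization one_mem_unitizationGrading

/-- An even central element as an element of the even centre of the unital hull. -/
def hullMk (h : HasStronglyIdentities 𝒜) (z : A) (hz : z ∈ evenCenter 𝒜) : HullCenter h :=
  CenterRing.mk _ _ z (inr_mem_evenCenter hz)

/-- The derivation `z ↦ ½ (z, x, x)` of the even centre of the unital hull. -/
noncomputable abbrev hullDerivation (h : HasStronglyIdentities 𝒜) {x : A} (hx : x ∈ 𝒜 1) :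
    Derivation Φ (HullCenter h) (HullCenter h) :=
  CenterRing.derivation h.unitization one_mem_unitizationGrading (inr_mem_unitizationGrading hx)

theorem hullDerivation_hullMk (h : HasStronglyIdentities 𝒜) {x z : A} (hx : x ∈ 𝒜 1)
    (hz : z ∈ evenCenter 𝒜) : hullDerivation h hx (hullMk h z hz) =
      (2⁻¹ : Φ) • hullMk h (associator z x x) (h.associator_mem_evenCenter hz hx) := by
  ext1
  rw [CenterRing.val_derivation, unitization_associator]
  simp [hullMk]

end CenterOfUnitization

/-! ### `F₀` embeds in its model -/

section Embedding

variable (Φ : Type u) [Field Φ] [CharZero Φ]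

/-- The model maps back to the unital hull of `F₀`, and the composite is the inclusion of `F₀`
because it is so on the generators. -/
theorem toModel_injective : Function.Injective (toModel Φ) := by
  let h := F0_hasStronglyIdentities Φ
  let z := hullMk h _ (toF0_genZ_mem Φ)
  have hx := toF0_genX_mem Φ
  let t := hullDerivation h hx z
  have hxx : toF0 Φ (genX Φ) * toF0 Φ (genX Φ) = 0 := by
    rw [← map_mul]
    exact idealMk_eq_zero F0Relator.x_sq
  have ht : hullDerivation h hx t = 0 := by
    have h₁ : associator (associator (toF0 Φ (genZ Φ)) (toF0 Φ (genX Φ)) (toF0 Φ (genX Φ)))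
        (toF0 Φ (genX Φ)) (toF0 Φ (genX Φ)) = 0 := by
      rw [← map_associator, ← map_associator]
      exact idealMk_eq_zero F0Relator.zxx
    have h₂ : hullDerivation h hx (hullDerivation h hx z) = 0 := by
      rw [hullDerivation_hullMk, Derivation.map_smul, hullDerivation_hullMk]
      ext1
      simp [hullMk, h₁]
    exact h₂
  -- `T ↦ t = D z` and `Z ↦ z`. This respects the derivations because `D t = 0`, which is the
  -- relator `((z, x, x), x, x)`; the relator `x²` matches the odd squares.
  let g : Φ[X][X] →ₐ[Φ] HullCenter h :=
    ((aeval z : (HullCenter h)[X] →ₐ[HullCenter h] HullCenter h).restrictScalars Φ).comp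
      (mapAlgHom (aeval t))
  have hg : ∀ s, g (modelDerivation Φ s) = hullDerivation h hx (g s) :=
    algHom_comp_derivation g
      (fun a => by simp [g, Derivation.map_aeval, ht]) (by simp [g, t])
  have hγ : g 0 = CenterRing.sq h.unitization one_mem_unitizationGrading
      (inr_mem_unitizationGrading hx) := by
    rw [map_zero]
    ext1
    rw [CenterRing.val_sq, ← Unitization.inr_mul, hxx]
    simp
  let ψ := (CenterRing.doubleHom _ _ (inr_mem_unitizationGrading hx)).comp (Double.map g hg hγ)
  have hψ : ∀ a, ψ (toModel Φ a) = (a : Unitization Φ (F0 Φ)) := by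
    intro a
    obtain ⟨a, rfl⟩ := idealMk_surjective _ a
    have h₁ : (ψ.comp (toModel Φ)).comp (toF0 Φ) =
        (hullHom Φ (F0 Φ)).comp (toF0 Φ) := by
      refine FreeNonUnitalNonAssocAlgebra.hom_ext _ ?_
      rintro (_ | _)
      · change ψ (freeToModel Φ (genZ Φ)) = (toF0 Φ (genZ Φ) : Unitization Φ (F0 Φ))
        rw [freeToModel_genZ]
        change CenterRing.doubleHom _ _ _ _ = _
        rw [CenterRing.doubleHom_apply]
        simp [g, z, hullMk]
      · change ψ (freeToModel Φ (genX Φ)) = (toF0 Φ (genX Φ) : Unitization Φ (F0 Φ))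
        rw [freeToModel_genX]
        change CenterRing.doubleHom _ _ _ _ = _
        rw [CenterRing.doubleHom_apply]
        simp
    exact DFunLike.congr_fun h₁ a
  intro a b hab
  have h₁ := (hψ a).symm.trans ((congrArg ψ hab).trans (hψ b))
  exact Unitization.inr_injective h₁

theorem F0_strongly : IsStronglyMinusOneOne (F0grading Φ) where
  __ := F0_hasStronglyIdentities Φ
  isCompl := by
    refine ⟨?_, (F0_hasStronglyIdentities Φ).codisjoint⟩
    rw [Submodule.disjoint_def]
    intro a h₀ h₁
    refine toModel_injective Φ ?_
    rw [map_zero]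
    exact Double.ext (Double.mem_grading_one.1 (toModel_mem Φ h₁))
      (Double.mem_grading_zero.1 (toModel_mem Φ h₀))

theorem F0_leftPow_ne_zero {k : ℕ} (hk : 0 < k) :
    leftPow (associator (toF0 Φ (genZ Φ)) (toF0 Φ (genX Φ)) (toF0 Φ (genX Φ))) k ≠ 0 := by
  intro h
  have h₁ := congrArg (toModel Φ) h
  rw [map_leftPow, map_associator, toModel_toF0, toModel_toF0, freeToModel_genX, freeToModel_genZ,
    model_associator, map_zero] at h₁
  have h₂ : ∀ n, (leftPow (Double.mk (2 * C X) 0 : Model Φ) (n + 1)) =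
      Double.mk ((2 * C X : Φ[X][X]) ^ (n + 1)) 0 := fun n => by
    induction n with
    | zero => simp [leftPow]
    | succ n ih =>
      rw [leftPow, ih]
      refine Double.ext ?_ ?_ <;> simp [pow_succ]
  obtain ⟨n, rfl⟩ := Nat.exists_eq_succ_of_ne_zero hk.ne'
  rw [Nat.succ_eq_add_one, h₂] at h₁
  have h₃ : ((2 * C X : Φ[X][X])) ^ (n + 1) = 0 := congrArg Double.even h₁
  exact pow_ne_zero _ (mul_ne_zero two_ne_zero (C_ne_zero.2 X_ne_zero)) h₃

end Embedding

/-! ### From a failing identity to nilpotency -/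

section Smallness

variable {Φ A : Type u} [Field Φ] [CharZero Φ] [NonUnitalNonAssocRing A] [Module Φ A]
  [IsScalarTower Φ A A] [SMulCommClass Φ A A] {𝒜 : ZMod 2 → Submodule Φ A}

/-- The two summands have opposite parities, so both vanish. But `bx = 0` does not give `b = 0`,
only that `b` is killed by the values of the derivation. -/
theorem even_eq_zero_and_mul_odd_eq_zero (h : IsStronglyMinusOneOne 𝒜) {x : A} (hx : x ∈ 𝒜 1)
    {p : Double (hullDerivation h.hasStronglyIdentities hx)
      (CenterRing.sq _ one_mem_unitizationGrading (inr_mem_unitizationGrading hx))}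
    (hp : CenterRing.doubleHom _ _ (inr_mem_unitizationGrading hx) p = 0)
    (z : HullCenter h.hasStronglyIdentities) :
    p.even = 0 ∧ hullDerivation h.hasStronglyIdentities hx z * p.odd = 0 := by
  rw [CenterRing.doubleHom_apply] at hp
  have h₀ := p.even.val_mem.1
  have h₁ : p.odd.val * (x : Unitization Φ A) ∈ unitizationGrading 𝒜 1 := by
    simpa using h.hasStronglyIdentities.unitization.mul_mem p.odd.val_mem.1
      (inr_mem_unitizationGrading hx)
  have h₂ : p.even.val ∈ unitizationGrading 𝒜 1 := by
    rw [eq_neg_of_add_eq_zero_left hp]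
    exact neg_mem h₁
  have h₃ : p.even.val = 0 := by
    ext
    · exact h₂.1 rfl
    · exact Submodule.disjoint_def.1 h.isCompl.disjoint _ h₀.2 h₂.2
  refine ⟨CenterRing.ext h₃, CenterRing.derivation_mul_eq_zero _ ?_ z⟩
  rwa [h₃, zero_add] at hp

/-- If a graded identity of `A` is evaluated in the model of `F₀` on a homogeneous family whose
even members are divisible by `T`, then `t` times the result vanishes at `T = t`, where
`t = ½ (z, x, x)` for an even central `z` and an odd `x`. -/
theorem IsStronglyMinusOneOne.map_model_eval (h : IsStronglyMinusOneOne 𝒜) {f : SuperPolynomial Φ}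
    (hf : IsSuperIdentity 𝒜 f) {v : ℕ × ZMod 2 → Φ[X][X] × Φ[X][X]}
    (hv₀ : ∀ n, ∃ a, v (n, 0) = (a * C X, 0)) (hv₁ : ∀ n, (v (n, 1)).1 = 0)
    {z x : A} (hz : z ∈ evenCenter 𝒜) (hx : x ∈ 𝒜 1) :
    let t := hullDerivation h.hasStronglyIdentities hx (hullMk h.hasStronglyIdentities z hz)
    let p := doubleEval (modelDerivation Φ) 0 v f
    mapAlgHom (aeval t) p.even = 0 ∧ C t * mapAlgHom (aeval t) p.odd = 0 := by
  intro t p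
  set j : Φ[X][X] →ₐ[Φ] (HullCenter h.hasStronglyIdentities)[X] := mapAlgHom (aeval t)
  have h₁ : Double.map (D' := scaledDerivative Φ t) (γ' := 0) j
      (algHom_comp_derivation j (by simp [j]) (by simp [j])) (map_zero j) p = _ :=
    map_doubleEval ..
  have h₂ := doubleEval_scaledDerivative
    (D := hullDerivation h.hasStronglyIdentities hx) (s := t)
    (γ := CenterRing.sq _ one_mem_unitizationGrading (inr_mem_unitizationGrading hx))
    (hullMk h.hasStronglyIdentities z hz)
    (v := fun q => (j (v q).1, j (v q).2)) (f := f) ?_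
  · change (doubleEval (scaledDerivative Φ t) 0 _ f).even = 0 ∧
      C t * (doubleEval (scaledDerivative Φ t) 0 _ f).odd = 0 at h₂
    rw [← h₁] at h₂
    exact h₂
  intro c u _ w _
  refine even_eq_zero_and_mul_odd_eq_zero h hx ?_ _
  -- The identity holds in `A`, not in its hull, so the substituted elements must lie in `A`. Odd
  -- ones do automatically; even ones do because they are multiples of `t`, which has no scalar
  -- part, although `w` may have one.
  have h₃ : ∀ q, ∃ a ∈ 𝒜 q.2, (a : Unitization Φ A) =
      CenterRing.doubleHom h.hasStronglyIdentities.unitization one_mem_unitizationGrading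
        (inr_mem_unitizationGrading hx)
        (Double.mk (aeval w (j (v q).1)) (c • aeval w (j (v q).2))) := by
    rintro ⟨n, i⟩
    refine exists_inr_of_fst_eq_zero ?_ ?_ <;> rcases zmod_two_cases i with rfl | rfl
    · obtain ⟨a, ha⟩ := hv₀ n
      rw [ha, CenterRing.doubleHom_apply]
      simp only [Double.even_mk, Double.odd_mk, map_zero, smul_zero, CenterRing.val_zero, zero_mul,
        add_zero]
      exact (CenterRing.val_mem _).1
    · rw [hv₁, CenterRing.doubleHom_apply]
      simp only [Double.even_mk, Double.odd_mk, map_zero, CenterRing.val_zero, zero_add,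
        CenterRing.val_smul, smul_mul_assoc]
      have h₄ := h.hasStronglyIdentities.unitization.mul_mem
        (CenterRing.val_mem (aeval w (j (v (n, 1)).2))).1 (inr_mem_unitizationGrading hx)
      rw [zero_add] at h₄
      exact Submodule.smul_mem _ c h₄
    · obtain ⟨a, ha⟩ := hv₀ n
      rw [ha, CenterRing.doubleHom_apply]
      have ht : t.val.fst = 0 := by
        simp [t, hullDerivation_hullMk, hullMk]
      simp [j, ht]
    · rw [hv₁, CenterRing.doubleHom_apply]
      simp
  choose a ha hav using h₃
  have h₄ := map_lift (CenterRing.doubleHom h.hasStronglyIdentities.unitization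
    one_mem_unitizationGrading (inr_mem_unitizationGrading hx))
    (fun q => Double.mk (aeval w (j (v q).1)) (c • aeval w (j (v q).2))) f
  refine h₄.trans ?_
  simp only [← hav]
  have h₅ := map_lift (hullHom Φ A) a f
  rw [hf a ha, map_zero] at h₅
  exact h₅.symm

theorem val_leftPow {h : HasStronglyIdentities 𝒜} (a : HullCenter h) (b : A)
    (hab : (b : Unitization Φ A) = a.val) :
    ∀ k, 0 < k → ((leftPow b k : A) : Unitization Φ A) = (a ^ k).val
  | 1, _ => by rw [pow_one, leftPow, hab]
  | k + 2, _ => by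
    rw [leftPow, Unitization.inr_mul, val_leftPow a b hab (k + 1) k.succ_pos, hab,
      pow_succ _ (k + 1), CenterRing.val_mul]

/-- A failure in `F₀` persists in the model by injectivity. Multiplying the family by suitable `c
T`, a nonzero constant of the derivation, makes it divisible by `T` without losing the failure. -/
theorem exists_model_eval_ne_zero {f : SuperPolynomial Φ}
    (hf : ¬ IsSuperIdentity (F0grading Φ) f) : ∃ v : ℕ × ZMod 2 → Φ[X][X] × Φ[X][X],
      (∀ n, ∃ a, v (n, 0) = (a * C X, 0)) ∧ (∀ n, (v (n, 1)).1 = 0) ∧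
      doubleEval (modelDerivation Φ) 0 v f ≠ 0 := by
  rw [IsSuperIdentity] at hf
  push Not at hf
  obtain ⟨v, hv, hne⟩ := hf
  have h₁ := map_lift (toModel Φ) v f
  have h₂ : doubleEval (modelDerivation Φ) 0
      (fun q => ((toModel Φ (v q)).even, (toModel Φ (v q)).odd)) f ≠ 0 := fun h₀ =>
    hne (toModel_injective Φ (by rw [map_zero]; exact h₁.trans h₀))
  by_contra! hcon
  refine h₂ (doubleEval_eq_zero_of_smul (e := C X) (C_ne_zero.2 X_ne_zero) (by simp) fun c =>
    hcon _ (fun n => ?_) fun n => ?_)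
  · have h₃ := Double.mem_grading_zero.1 (toModel_mem Φ (hv (n, 0)))
    exact ⟨c • (toModel Φ (v (n, 0))).even, by
      rw [h₃, zero_mul, smul_mul_assoc, mul_smul_comm]⟩
  · have h₃ := Double.mem_grading_one.1 (toModel_mem Φ (hv (n, 1)))
    simp [h₃]

/-- If `q(s t) = 0` for all squares `s`, then `t` is nilpotent. -/
theorem pow_natDegree_eq_zero {R : Type u} [CommRing R] [Algebra Φ R] {q : Φ[X]} (hq : q ≠ 0)
    {t : R} (ht : ∀ c : Φ, aeval (c ^ 2 • t) q = 0) : t ^ q.natDegree = 0 := by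
  have h₁ : ((q.map (algebraMap Φ R)).comp (C t * X)) = 0 := by
    have hT : (Set.range fun n : ℕ => (n : Φ) ^ 2).Infinite := by
      refine Set.infinite_range_of_injective fun m n hmn => ?_
      have : m ^ 2 = n ^ 2 := by exact_mod_cast hmn
      exact Nat.pow_left_injective two_ne_zero this
    refine polynomial_eq_zero_of_infinite _ hT ?_
    rintro _ ⟨n, rfl⟩
    rw [← ht n, eval_comp, aeval_def, eval_map, eval_mul, eval_C, eval_X, Algebra.smul_def,
      mul_comm t]
  have h₂ := congrArg (coeff · q.natDegree) h₁
  simp only [comp_C_mul_X_coeff, coeff_map, coeff_natDegree, coeff_zero, ← Algebra.smul_def] at h₂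
  exact (smul_eq_zero.1 h₂).resolve_left (leadingCoeff_ne_zero.2 hq)

theorem exists_leftPow_eq_zero {f : SuperPolynomial Φ} (hf : ¬ IsSuperIdentity (F0grading Φ) f) :
    ∃ k : ℕ, 0 < k ∧ ∀ (A : Type u) [NonUnitalNonAssocRing A] [Module Φ A] [IsScalarTower Φ A A]
      [SMulCommClass Φ A A] (𝒜 : ZMod 2 → Submodule Φ A), IsStronglyMinusOneOne 𝒜 →
      IsSuperIdentity 𝒜 f → ∀ z ∈ evenCenter 𝒜, ∀ x ∈ 𝒜 1,
        leftPow (associator z x x) k = 0 := by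
  obtain ⟨v, hv₀, hv₁, hne⟩ := exists_model_eval_ne_zero hf
  -- `q` is a nonzero coefficient of the value in the model, chosen before `A`, so the exponent is
  -- uniform. The factor `X` is needed when it comes from the odd part, and it also makes the
  -- exponent positive.
  obtain ⟨q, hq, hqA⟩ : ∃ q : Φ[X], q ≠ 0 ∧ ∀ (A : Type u) [NonUnitalNonAssocRing A] [Module Φ A]
      [IsScalarTower Φ A A] [SMulCommClass Φ A A] (𝒜 : ZMod 2 → Submodule Φ A)
      (h : IsStronglyMinusOneOne 𝒜), IsSuperIdentity 𝒜 f → ∀ (z : A) (hz : z ∈ evenCenter 𝒜)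
      (x : A) (hx : x ∈ 𝒜 1), aeval (hullDerivation h.hasStronglyIdentities hx
        (hullMk h.hasStronglyIdentities z hz)) (X * q) = 0 := by
    by_cases h₀ : (doubleEval (modelDerivation Φ) 0 v f).even = 0
    · have h₁ : (doubleEval (modelDerivation Φ) 0 v f).odd ≠ 0 := fun h₁ => hne (Double.ext h₀ h₁)
      obtain ⟨i, hi⟩ := Polynomial.ext_iff.not.1 h₁ |> not_forall.1
      refine ⟨_, hi, fun A _ _ _ _ 𝒜 h hfA z hz x hx => ?_⟩
      have h₂ := congrArg (coeff · i) (h.map_model_eval hfA hv₀ hv₁ hz hx).2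
      simpa using h₂
    · obtain ⟨i, hi⟩ := Polynomial.ext_iff.not.1 h₀ |> not_forall.1
      refine ⟨_, hi, fun A _ _ _ _ 𝒜 h hfA z hz x hx => ?_⟩
      have h₂ := congrArg (coeff · i) (h.map_model_eval hfA hv₀ hv₁ hz hx).1
      simp only [coe_mapAlgHom, coeff_map, RingHom.coe_coe, coeff_zero] at h₂
      rw [map_mul, h₂, mul_zero]
  have hXq : X * q ≠ 0 := mul_ne_zero X_ne_zero hq
  have hdeg : 0 < (X * q).natDegree := by
    rw [natDegree_X_mul hq]
    exact Nat.succ_pos _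
  refine ⟨_, hdeg, fun A _ _ _ _ 𝒜 h hfA z hz x hx => ?_⟩
  have ht := pow_natDegree_eq_zero hXq (t := hullDerivation h.hasStronglyIdentities hx
    (hullMk h.hasStronglyIdentities z hz)) fun c => by
      -- `(z, cx, cx) = c² (z, x, x)`, so applying the relation to `cx` puts `c² t` in place of `t`.
      have hcx : c • x ∈ 𝒜 1 := Submodule.smul_mem _ c hx
      rw [← hqA A 𝒜 h hfA z hz (c • x) hcx]
      congr 1
      congr 1
      rw [hullDerivation_hullMk, hullDerivation_hullMk]
      ext1
      simp only [hullMk, CenterRing.val_smul, CenterRing.val_mk, associator_apply, mul_smul_comm,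
        smul_mul_assoc, ← smul_sub, Unitization.inr_smul]
      module
  rw [hullDerivation_hullMk, _root_.smul_pow] at ht
  have h₁ := (smul_eq_zero.1 ht).resolve_left (pow_ne_zero _ (by norm_num))
  refine Unitization.inr_injective (R := Φ) ?_
  rw [val_leftPow (hullMk h.hasStronglyIdentities (associator z x x)
    (h.hasStronglyIdentities.associator_mem_evenCenter hz hx)) _ rfl _ hdeg, h₁]
  simp

end Smallness

end MinusOneOne

theorem proposition4p1 {Φ : Type u} [Field Φ] [CharZero Φ] (V : MinusOneOne.StronglyVariety Φ) :
    V.IsSmall ↔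
      ∃ k : ℕ, 0 < k ∧
        ∀ (A : Type u) [NonUnitalNonAssocRing A] [Module Φ A] [IsScalarTower Φ A A]
          [SMulCommClass Φ A A] (𝒜 : ZMod 2 → Submodule Φ A), V.Contains 𝒜 →
          ∀ z ∈ 𝒜 0, (∀ a : A, z * a = a * z) → ∀ x ∈ 𝒜 1,
            MinusOneOne.leftPow (associator z x x) k = 0 := by
  constructor
  · intro hV
    obtain ⟨f, hf, hfF⟩ : ∃ f ∈ V.identities,
        ¬ MinusOneOne.IsSuperIdentity (MinusOneOne.F0grading Φ) f := by
      by_contra! h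
      exact hV ⟨MinusOneOne.F0_strongly Φ, h⟩
    obtain ⟨k, hk, h⟩ := MinusOneOne.exists_leftPow_eq_zero hfF
    exact ⟨k, hk, fun A _ _ _ _ 𝒜 hA z hz hc x hx =>
      h A 𝒜 hA.strongly (hA.satisfies f hf) z ⟨hz, hc⟩ x hx⟩
  · rintro ⟨k, hk, h⟩ hF
    have hz := MinusOneOne.toF0_genZ_mem Φ
    exact MinusOneOne.F0_leftPow_ne_zero Φ hk
      (h _ _ hF _ hz.1 hz.2 _ (MinusOneOne.toF0_genX_mem Φ))
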